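/- Let $m,n\ge 1$ be integers, let $\mathbb{B}^m$ be the open unit ball of $\mathbb{C}^m$, and write $\langle z,w\rangle=\sum_j z_j\overline{w}_j$. Let $a(i)>0$ $(i\ge 0)$ be such that $K(z,w)=\sum_{i\ge 0}a(i)\langle z,w\rangle^i$ converges for $z,w\in\mathbb{B}^m$. Let $\widehat{\mathcal{H}}$ and $H_n^2$ be the Hilbert spaces of functions on $\mathbb{B}^m$ with reproducing kernels $K(z,w)$ and $(1-\langle z,w\rangle)^{-n}$, respectively. Assume that the multiplications by the coordinate functions are bounded on $\widehat{\mathcal{H}}$, let $\mathbf{T}=(T_1,\dots,T_m)$ be the tuple of their adjoints, and let $\mathbf{S}^*=(S_1^*,\dots,S_m^*)$ be the tuple of the adjoints of the (bounded) multiplications by the coordinate functions on $H_n^2$. The class $\mathcal{B}_1^m(\mathbb{B}^m)$ consists of the commuting $m$-tuples $\mathbf{A}$ of bounded operators on a complex Hilbert space $\mathcal{H}$ such that for every $w\in\mathbb{B}^m$ the operator $\mathbf{A}-w:x\mapsto((A_i-w_i)x)_i$ from $\mathcal{H}$ to $\mathcal{H}^m$ has closed range and a one-dimensional kernel, and such that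 these kernels together span a dense subspace of $\mathcal{H}$. For such $\mathbf{A}$ the curvature is $$\mathcal{K}_{\mathbf{A}}(w)=-\sum_{i,j=1}^m\frac{\partial^2\log\|\gamma(w)\|^2}{\partial w_i\partial\overline{w}_j}\,dw_i\wedge d\overline{w}_j,$$ where $\gamma$ is any non-vanishing holomorphic $\mathcal{H}$-valued function near $w$ with $\gamma(v)\in\ker(\mathbf{A}-v)$. The tuple $\mathbf{A}$ is an $n$-hypercontraction if $(I-\mathbf{M}_{\mathbf{A}})^k(I)\ge 0$ for $1\le k\le n$, where $\mathbf{M}_{\mathbf{A}}(X)=\sum_{i=1}^m A_i^*XA_i$. Two tuples $\mathbf{A},\mathbf{B}$ are similar if there is a bounded invertible operator $X$ with $XA_i=B_iX$ for all $i$. Suppose that $\mathbf{T}\in\mathcal{B}_1^m(\mathbb{B}^m)$ and that $\mathbf{T}$ is an $n$-hypercontraction. Then $\mathbf{S}^*\in\mathcal{B}_1^m(\mathbb{B}^m)$, and $\mathbf{T}$ is similar to $\mathbf{S}^*$ if and only if there is a bounded plurisubharmonic function $\psi$ of class $C^2$ on $\mathbb{B}^m$ such that $$\mathcal{K}_{\mathbf{S}^*}(w)-\mathcal{K}_{\mathbf{T}}(w)=\sum_{i,j=1}^m\frac{\partial^2\psi(w)}{\partial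 w_i\partial\overline{w}_j}\,dw_i\wedge d\overline{w}_j,\qquad w\in\mathbb{B}^m.$$ -/

import Mathlib

open ContinuousLinearMap
open scoped ComplexConjugate

noncomputable section

namespace CDTuple

/-- `ℂ^m` with its Euclidean norm. -/
abbrev Cn (m : ℕ) : Type := EuclideanSpace ℂ (Fin m)

/-- The open unit ball of `ℂ^m`. -/
abbrev unitBall (m : ℕ) : Set (Cn m) := Metric.ball 0 1

/-! ### Tuples of operators -/

section Tuples

variable {m : ℕ}
variable {H : Type*} [NormedAddCommGroup H] [InnerProductSpace ℂ H]

/-- The joint kernel `⋂ i, ker (T i - w i)`. -/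
def jointKer (T : Fin m → H →L[ℂ] H) (w : Cn m) : Submodule ℂ H :=
  ⨅ i, LinearMap.ker ((T i - w i • (1 : H →L[ℂ] H) : H →L[ℂ] H) : H →ₗ[ℂ] H)

/-- The Cowen–Douglas class of rank `n` over the set `Ω` (a connected open set in practice). -/
structure IsCowenDouglas (n : ℕ) (Ω : Set (Cn m)) (T : Fin m → H →L[ℂ] H) : Prop where
  rank_pos : 0 < n
  commute : ∀ i j, Commute (T i) (T j)
  isClosed_range : ∀ w ∈ Ω,
    IsClosed (Set.range fun (x : H) (i : Fin m) => T i x - w i • x)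
  dense_span : (⨆ w ∈ Ω, jointKer T w).topologicalClosure = ⊤
  finrank_jointKer : ∀ w ∈ Ω, Module.finrank ℂ (jointKer T w) = n

/-- Similarity of two tuples: one bounded invertible operator intertwines all the entries. -/
def Similar {H' : Type*} [NormedAddCommGroup H'] [InnerProductSpace ℂ H']
    (T : Fin m → H →L[ℂ] H) (S : Fin m → H' →L[ℂ] H') : Prop :=
  ∃ X : H ≃L[ℂ] H', ∀ i x, X (T i x) = S i (X x)

variable [CompleteSpace H]

/-- The map `X ↦ ∑ i, (T i)* X (T i)` on bounded operators. -/
def conjSum (T : Fin m → H →L[ℂ] H) : Module.End ℂ (H →L[ℂ] H) where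
  toFun X := ∑ i, adjoint (T i) * X * T i
  map_add' X Y := by simp [mul_add, add_mul, Finset.sum_add_distrib]
  map_smul' c X := by simp [Finset.smul_sum]

/-- `T` is an `n`-hypercontraction: `(1 - conjSum T)^k` applied to the identity operator is
a positive operator for `1 ≤ k ≤ n`. -/
def IsHypercontraction (n : ℕ) (T : Fin m → H →L[ℂ] H) : Prop :=
  ∀ k, 1 ≤ k → k ≤ n → (((1 - conjSum T) ^ k) (1 : H →L[ℂ] H)).IsPositive

end Tuples

/-! ### Wirtinger derivatives and curvature -/

section Curvature

variable {m : ℕ}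

/-- `∂f/∂w_i = (∂f/∂x_i - I ∂f/∂y_i) / 2`, where `w_i = x_i + I y_i`. -/
def dW (i : Fin m) (f : Cn m → ℂ) (w : Cn m) : ℂ :=
  (fderiv ℝ f w (EuclideanSpace.single i 1)
    - Complex.I * fderiv ℝ f w (EuclideanSpace.single i Complex.I)) / 2

/-- `∂f/∂w̄_i = (∂f/∂x_i + I ∂f/∂y_i) / 2`, where `w_i = x_i + I y_i`. -/
def dWbar (i : Fin m) (f : Cn m → ℂ) (w : Cn m) : ℂ :=
  (fderiv ℝ f w (EuclideanSpace.single i 1)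
    + Complex.I * fderiv ℝ f w (EuclideanSpace.single i Complex.I)) / 2

/-- The matrix `(∂²u/∂w_i∂w̄_j)` of a real function `u`, that is, the coefficients of the
`(1,1)`-form `∂∂̄u = ∑ i j, ∂²u/∂w_i∂w̄_j dw_i ∧ dw̄_j`. -/
def complexHessian (u : Cn m → ℝ) (w : Cn m) : Matrix (Fin m) (Fin m) ℂ :=
  Matrix.of fun i j => dW i (dWbar j fun v => (u v : ℂ)) w

variable {H : Type*} [NormedAddCommGroup H] [InnerProductSpace ℂ H]

/-- `γ` is a non-vanishing holomorphic section over `U` of the bundle with fibres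
`jointKer T w`. -/
structure IsHolSection (T : Fin m → H →L[ℂ] H) (U : Set (Cn m)) (γ : Cn m → H) : Prop where
  holomorphic : DifferentiableOn ℂ γ U
  mem : ∀ w ∈ U, γ w ∈ jointKer T w
  ne_zero : ∀ w ∈ U, γ w ≠ 0

open Classical in
/-- The curvature at `w` of the Hermitian holomorphic line bundle with fibres `jointKer T w`
(for `T` in the Cowen–Douglas class of rank one), as the matrix of the coefficients of
`dw_i ∧ dw̄_j`, namely `-∂² log ‖γ‖² / ∂w_i ∂w̄_j` for a non-vanishing holomorphic section `γ`
near `w`. For a line bundle the value does not depend on `γ`; it is `0` by convention if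
there is no such section. -/
def curvature (T : Fin m → H →L[ℂ] H) (w : Cn m) : Matrix (Fin m) (Fin m) ℂ :=
  if h : ∃ γ : Cn m → H, ∃ U : Set (Cn m), IsOpen U ∧ w ∈ U ∧ IsHolSection T U γ then
    -complexHessian (fun v => Real.log (‖h.choose v‖ ^ 2)) w
  else 0

end Curvature

/-! ### Plurisubharmonic functions -/

/-- Plurisubharmonicity of a finite-valued function on an open set `Ω`: upper semicontinuity and
the sub-mean value inequality over the boundary of every closed disc
`{a + λ b : |λ| ≤ 1} ⊆ Ω` in a complex line. -/
structure IsPlurisubharmonicOn {m : ℕ} (u : Cn m → ℝ) (Ω : Set (Cn m)) : Prop where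
  upperSemicontinuousOn : UpperSemicontinuousOn u Ω
  submean : ∀ a b : Cn m, (∀ l : ℂ, ‖l‖ ≤ 1 → a + l • b ∈ Ω) →
    CircleIntegrable (fun l : ℂ => u (a + l • b)) 0 1 ∧
      u a ≤ Real.circleAverage (fun l : ℂ => u (a + l • b)) 0 1

/-! ### Coordinate multiplication on function spaces on the ball -/

/-- `M` is the tuple of the multiplication operators by the coordinate functions on a
Hilbert space of functions on the unit ball. -/
def IsCoordMul {m : ℕ} {H : Type*} [NormedAddCommGroup H] [InnerProductSpace ℂ H]
    [RKHS ℂ H (unitBall m) ℂ] (M : Fin m → H →L[ℂ] H) : Prop :=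
  ∀ (i : Fin m) (f : H) (z : unitBall m), M i f z = (z : Cn m) i * f z

end CDTuple

end

/-! The kernel functions of the two spaces, taken at conjugate points, form holomorphic eigenvector
sections `γ` and `γ'` over the ball, with Gram functions `∑ a(l) ⟨v, u⟩^l` and `∑ b(l) ⟨v, u⟩^l`,
where `b(l)` is the binomial coefficient of `l + n - 1` over `n - 1`. On Gram matrices `conjSum T`
acts as multiplication by `⟨v, u⟩`. So `(1 - conjSum T)^n 1` has coefficients `c = backDiff^[n] a`,
and hypercontractivity forces `c ≥ 0` (`coeff_nonneg`).

The quotient `q = ‖γ‖² / ‖γ'‖²` equals `∑ c(l) ‖v‖^(2l)`: it is radial, at least `a 0`, and `log q`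
is plurisubharmonic. The difference of the curvatures is the complex Hessian of `log q`, so
everything turns on whether `q` is bounded.

If the tuples are similar, the intertwiner carries `γ'` to a holomorphic multiple of `γ`; the
maximum principle on discs and radiality of `q` bound `q`, and `ψ = log q` works. Conversely, given
a bounded `ψ`, the function `ψ - log q` is pluriharmonic; its mean value property and radiality
bound `log q` above, hence the partial sums of `c`. Summing `n` times gives `a 0 * b ≤ a ≤ B * b`.
As all Gram functions are positive combinations of the same positive forms `⟨v, u⟩^l`, comparable
coefficients yield a bounded invertible map `γ u ↦ γ' u`, which intertwines the tuples (`similar`).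

The adjoint tuple on the second space is in the Cowen–Douglas class because `(1 - conjSum)^n 1` is
there the projection onto `γ' 0` and consecutive `b(l)` have ratio tending to `1`. -/

section SeveralVariables

/-! ### Holomorphic maps of several variables: Cauchy estimates and smoothness. -/

open Metric Set Filter Topology

variable {E F : Type*} [NormedAddCommGroup E] [NormedSpace ℂ E]
  [NormedAddCommGroup F] [NormedSpace ℂ F]

theorem norm_fderiv_le_of_norm_le_ball {f : E → F} {x : E} {r B : ℝ} (hr : 0 < r)
    (hf : DifferentiableOn ℂ f (ball x r)) (hB : ∀ y ∈ ball x r, ‖f y‖ ≤ B) :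
    ‖fderiv ℂ f x‖ ≤ 2 * B / r := by
  refine Complex.norm_fderiv_le_div_of_mapsTo_ball hf (fun y hy => ?_) hr
  rw [mem_closedBall, dist_eq_norm]
  linarith [norm_sub_le (f y) (f x), hB y hy, hB x (mem_ball_self hr)]

/-- On the ball of half the radius Cauchy's estimate turns the bounds on the terms into summable
bounds on their derivatives, so the series may be differentiated termwise. -/
theorem differentiableAt_tsum_of_norm_le_ball [CompleteSpace F] {f : ℕ → E → F} {x : E} {r : ℝ}
    {u : ℕ → ℝ} (hr : 0 < r) (hu : Summable u)
    (hf : ∀ n, DifferentiableOn ℂ (f n) (ball x r)) (hfu : ∀ n, ∀ y ∈ ball x r, ‖f n y‖ ≤ u n) :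
    DifferentiableAt ℂ (fun y => ∑' n, f n y) x := by
  have hx : x ∈ ball x (r / 2) := mem_ball_self (by positivity)
  have hsub : ∀ y ∈ ball x (r / 2), ball y (r / 2) ⊆ ball x r := fun y hy =>
    ball_subset_ball' (by rw [mem_ball] at hy; linarith)
  have hsub' : ball x (r / 2) ⊆ ball x r := ball_subset_ball (by linarith)
  refine (hasFDerivAt_tsum_of_isPreconnected (u := fun n => 2 * u n / (r / 2))
    (f' := fun n y => fderiv ℂ (f n) y) ((hu.mul_left 2).div_const _) isOpen_ball
    (convex_ball x (r / 2)).isPreconnected (fun n y hy => ?_) (fun n y hy => ?_) hx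
    (Summable.of_norm_bounded hu fun n => hfu n x (hsub' hx)) hx).differentiableAt
  · exact ((hf n).differentiableAt (isOpen_ball.mem_nhds (hsub' hy))).hasFDerivAt
  · exact norm_fderiv_le_of_norm_le_ball (by positivity) ((hf n).mono (hsub y hy))
      fun z hz => hfu n z (hsub y hy hz)

/-- Schwarz lemma of order two: the first-order Taylor remainder is `o(‖y - x‖)` and bounded by `4 *
B` on the ball (`2 * B` from the values, `2 * B` from the linear term). -/
theorem norm_sub_sub_fderiv_le_of_norm_le_ball {f : E → F} {x : E} {r B : ℝ} (hr : 0 < r)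
    (hf : DifferentiableOn ℂ f (ball x r)) (hB : ∀ y ∈ ball x r, ‖f y‖ ≤ B) {y : E}
    (hy : y ∈ ball x r) :
    ‖f y - f x - fderiv ℂ f x (y - x)‖ ≤ 4 * B * (‖y - x‖ / r) ^ 2 := by
  have hx := mem_ball_self (x := x) hr
  have hfx : HasFDerivAt f (fderiv ℂ f x) x :=
    (hf.differentiableAt (isOpen_ball.mem_nhds hx)).hasFDerivAt
  set g : E → F := fun z => f z - f x - fderiv ℂ f x (z - x) with hg
  have hgx : g x = 0 := by simp [hg]
  have h := Complex.dist_le_mul_div_pow_of_mapsTo_ball_of_isLittleO (n := 1) (f := g) (c := x)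
    (R₁ := r) (R₂ := 4 * B) (z := y) ?_ ?_ ?_ hy
  · rw [hgx, dist_zero_right, dist_eq_norm] at h
    exact h
  · exact (hf.sub_const _).sub (by fun_prop)
  · intro z hz
    have hzx : ‖z - x‖ ≤ r := by rw [← dist_eq_norm]; exact (mem_ball.1 hz).le
    have h1 : ‖fderiv ℂ f x (z - x)‖ ≤ 2 * B :=
      calc ‖fderiv ℂ f x (z - x)‖ ≤ ‖fderiv ℂ f x‖ * ‖z - x‖ := ContinuousLinearMap.le_opNorm _ _
        _ ≤ (2 * B / r) * r := by
          have h2 := norm_fderiv_le_of_norm_le_ball hr hf hB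
          exact mul_le_mul h2 hzx (norm_nonneg _) ((norm_nonneg _).trans h2)
        _ = 2 * B := div_mul_cancel₀ _ hr.ne'
    rw [hgx, mem_closedBall, dist_zero_right]
    linarith [norm_sub_le (f z - f x) (fderiv ℂ f x (z - x)), norm_sub_le (f z) (f x), hB z hz,
      hB x hx]
  · simpa [hgx, hg] using! hfx.isLittleO

/-- The directional derivatives of a holomorphic map are holomorphic. -/
theorem DifferentiableOn.fderiv_apply_of_isOpen [CompleteSpace F] {f : E → F} {U : Set E}
    (hU : IsOpen U) (hf : DifferentiableOn ℂ f U) (e : E) :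
    DifferentiableOn ℂ (fun v => fderiv ℂ f v e) U := by
  intro x hx
  refine DifferentiableAt.differentiableWithinAt ?_
  obtain ⟨r, hr, B, hrU, hB⟩ : ∃ r > 0, ∃ B : ℝ, ball x (3 * r) ⊆ U ∧
      ∀ y ∈ ball x (3 * r), ‖f y‖ ≤ B := by
    have hc : ContinuousAt f x := (hf.differentiableAt (hU.mem_nhds hx)).continuousAt
    have h2 : ∀ᶠ y in 𝓝 x, y ∈ U ∧ ‖f y‖ < ‖f x‖ + 1 :=
      (hU.eventually_mem hx).and (hc.norm.eventually (gt_mem_nhds (by linarith)))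
    obtain ⟨r, hr, h⟩ := Metric.eventually_nhds_iff_ball.1 h2
    refine ⟨r / 3, by positivity, ‖f x‖ + 1, fun y hy => (h y ?_).1, fun y hy => (h y ?_).2.le⟩ <;>
    simpa [mul_div_cancel₀] using hy
  -- The derivative is linear in `e`, so `e` may be rescaled until all translates below stay in the
  -- larger ball.
  wlog he : ‖e‖ ≤ r generalizing e
  · have hpos : 0 < ‖e‖ := hr.trans (not_le.1 he)
    have h := (this (((r / ‖e‖ : ℝ) : ℂ) • e) (by
      rw [norm_smul, Complex.norm_real, Real.norm_of_nonneg (by positivity)]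
      field_simp [hpos.ne']; rfl)).const_smul (((‖e‖ / r : ℝ)) : ℂ)
    refine h.congr_of_eventuallyEq (Eventually.of_forall fun v => ?_)
    simp only [Pi.smul_apply, map_smul, smul_smul]
    rw [← Complex.ofReal_mul, show ‖e‖ / r * (r / ‖e‖) = 1 by field_simp]
    simp
  -- Dyadic difference quotients. The second-order remainder puts `D k` within `B / 2^k` of the
  -- derivative uniformly on `ball x r`, so the derivative is `D 0` plus a normally convergent
  -- telescoping series of holomorphic maps.
  set D : ℕ → E → F := fun k v => (2 : ℂ) ^ k • (f (v + ((2 : ℂ) ^ k)⁻¹ • e) - f v) with hD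
  have hek : ∀ k : ℕ, ‖((2 : ℂ) ^ k)⁻¹ • e‖ ≤ r := fun k => by
    rw [norm_smul]
    have : ‖((2 : ℂ) ^ k)⁻¹‖ ≤ 1 := by
      rw [norm_inv, norm_pow]
      exact inv_le_one_of_one_le₀ (one_le_pow₀ (by simp))
    nlinarith [norm_nonneg e]
  have hmem : ∀ v ∈ ball x r, ∀ k : ℕ, v + ((2 : ℂ) ^ k)⁻¹ • e ∈ ball x (3 * r) := by
    intro v hv k
    rw [mem_ball, dist_eq_norm] at *
    have := norm_add_le (v - x) (((2 : ℂ) ^ k)⁻¹ • e)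
    rw [add_sub_right_comm]
    linarith [hek k]
  have hsub : ball x r ⊆ ball x (3 * r) := ball_subset_ball (by linarith)
  have hDd : ∀ k, DifferentiableOn ℂ (D k) (ball x r) := fun k => by
    refine DifferentiableOn.const_smul (DifferentiableOn.sub ?_ (hf.mono (hsub.trans hrU))) _
    exact hf.comp (by fun_prop) fun v hv => hrU (hmem v hv k)
  have hDlim : ∀ v ∈ ball x r, ∀ k, ‖D k v - fderiv ℂ f v e‖ ≤ B * (1 / 2) ^ k := by
    intro v hv k
    have hv2 : ball v (2 * r) ⊆ ball x (3 * r) :=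
      ball_subset_ball' (by rw [mem_ball] at hv; linarith)
    have h2k : (2 : ℂ) ^ k ≠ 0 := pow_ne_zero k two_ne_zero
    have h := norm_sub_sub_fderiv_le_of_norm_le_ball (f := f) (x := v) (r := 2 * r) (B := B)
      (by positivity) (hf.mono (hv2.trans hrU)) (fun y hy => hB y (hv2 hy))
      (y := v + ((2 : ℂ) ^ k)⁻¹ • e) (by
        rw [mem_ball, dist_eq_norm, add_sub_cancel_left]; linarith [hek k])
    have hB0 : 0 ≤ B := (norm_nonneg _).trans (hB v (hsub hv))
    rw [add_sub_cancel_left, map_smul] at h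
    have hDk : D k v - fderiv ℂ f v e =
        (2 : ℂ) ^ k • (f (v + ((2 : ℂ) ^ k)⁻¹ • e) - f v - ((2 : ℂ) ^ k)⁻¹ • fderiv ℂ f v e) := by
      simp only [hD]
      rw [smul_sub _ (f _ - f v), smul_smul, mul_inv_cancel₀ h2k, one_smul]
    rw [hDk, norm_smul, norm_pow, Complex.norm_ofNat]
    calc (2 : ℝ) ^ k * _ ≤ 2 ^ k * (4 * B * (‖((2 : ℂ) ^ k)⁻¹ • e‖ / (2 * r)) ^ 2) := by gcongr
      _ = B * (1 / 2) ^ k * (‖e‖ / r) ^ 2 := by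
        rw [norm_smul, norm_inv, norm_pow, Complex.norm_ofNat, one_div, inv_pow]
        field_simp; ring
      _ ≤ B * (1 / 2) ^ k * 1 := by
        gcongr
        exact pow_le_one₀ (by positivity) ((div_le_one hr).2 he)
      _ = _ := mul_one _
  have hsum : DifferentiableAt ℂ (fun v => ∑' k, (D (k + 1) v - D k v)) x := by
    refine differentiableAt_tsum_of_norm_le_ball (u := fun k => 2 * B * (1 / 2 : ℝ) ^ k) hr
      (summable_geometric_two.mul_left _) (fun k => (hDd (k + 1)).sub (hDd k)) fun k v hv => ?_
    have h1 := hDlim v hv (k + 1)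
    have h2 := hDlim v hv k
    have hB0 : 0 ≤ B * (1 / 2) ^ k := (norm_nonneg _).trans h2
    have h3 := norm_sub_le (D (k + 1) v - fderiv ℂ f v e) (D k v - fderiv ℂ f v e)
    rw [sub_sub_sub_cancel_right] at h3
    rw [pow_succ] at h1
    linarith
  have hD0 : DifferentiableAt ℂ (D 0) x :=
    (hDd 0).differentiableAt (isOpen_ball.mem_nhds (mem_ball_self hr))
  refine (hsum.add hD0).congr_of_eventuallyEq ?_
  filter_upwards [ball_mem_nhds x hr] with v hv
  have htend : Tendsto (fun k => D k v) atTop (𝓝 (fderiv ℂ f v e)) := by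
    rw [tendsto_iff_norm_sub_tendsto_zero]
    refine squeeze_zero (fun _ => norm_nonneg _) (hDlim v hv) ?_
    simpa using (tendsto_pow_atTop_nhds_zero_of_lt_one (by norm_num : (0 : ℝ) ≤ 1 / 2)
      (by norm_num)).const_mul B
  have hsummable : Summable fun k => D (k + 1) v - D k v := by
    refine Summable.of_norm_bounded ((summable_geometric_two).mul_left (2 * B)) fun k => ?_
    have h1 := hDlim v hv (k + 1)
    have h2 := hDlim v hv k
    have hB0 : 0 ≤ B * (1 / 2) ^ k := (norm_nonneg _).trans h2
    have h3 := norm_sub_le (D (k + 1) v - fderiv ℂ f v e) (D k v - fderiv ℂ f v e)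
    rw [sub_sub_sub_cancel_right] at h3
    rw [pow_succ] at h1
    linarith
  have h5 : ∑' k, (D (k + 1) v - D k v) = fderiv ℂ f v e - D 0 v := by
    refine tendsto_nhds_unique hsummable.hasSum.tendsto_sum_nat ?_
    simp_rw [Finset.sum_range_sub (fun k => D k v)]
    exact htend.sub_const _
  simp [h5]

/-- Holomorphic maps of several complex variables are smooth. -/
theorem DifferentiableOn.contDiffOn_of_isOpen [FiniteDimensional ℂ E] [CompleteSpace F]
    {f : E → F} {U : Set E} (hU : IsOpen U) (hf : DifferentiableOn ℂ f U) (n : ℕ) :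
    ContDiffOn ℂ n f U := by
  induction n generalizing f with
  | zero => simpa using hf.continuousOn
  | succ n ih =>
    push_cast
    rw [contDiffOn_succ_iff_fderiv_of_isOpen hU]
    exact ⟨hf, by simp, contDiffOn_clm_apply.2 fun e => ih (hf.fderiv_apply_of_isOpen hU e)⟩

end SeveralVariables

/-! ### Joint eigenvectors and sections with power series Gram functions. -/

namespace CDTuple

open Metric Set Filter Topology InnerProductSpace

section Eigenvectors

variable {m : ℕ} {H : Type*} [NormedAddCommGroup H] [InnerProductSpace ℂ H]
  {T : Fin m → H →L[ℂ] H}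

theorem mem_jointKer_iff {w : Cn m} {x : H} : x ∈ jointKer T w ↔ ∀ i, T i x = w i • x := by
  simp [jointKer, Submodule.mem_iInf, sub_eq_zero]

variable [CompleteSpace H]

theorem conjSum_apply (X : H →L[ℂ] H) : conjSum T X = ∑ i, adjoint (T i) * X * T i := rfl

theorem inner_conjSum (X : H →L[ℂ] H) (x y : H) :
    inner ℂ x (conjSum T X y) = ∑ i, inner ℂ (T i x) (X (T i y)) := by
  simp [conjSum_apply, adjoint_inner_right]

/-- Between joint eigenvectors `conjSum T` is multiplication by the scalar `⟨v, u⟩`. This turns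
operator inequalities into statements about power series in `⟨v, u⟩`. -/
theorem inner_conjSum_of_mem {u v : Cn m} {x y : H} (hx : x ∈ jointKer T u)
    (hy : y ∈ jointKer T v) (X : H →L[ℂ] H) :
    inner ℂ x (conjSum T X y) = inner ℂ u v * inner ℂ x (X y) := by
  rw [mem_jointKer_iff] at hx hy
  simp only [inner_conjSum, hx, hy, map_smul, inner_smul_left, inner_smul_right,
    PiLp.inner_apply, RCLike.inner_apply, Finset.sum_mul]
  exact Finset.sum_congr rfl fun i _ => by ring

theorem inner_conjSum_pow_of_mem {u v : Cn m} {x y : H} (hx : x ∈ jointKer T u)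
    (hy : y ∈ jointKer T v) (X : H →L[ℂ] H) (k : ℕ) :
    inner ℂ x ((conjSum T ^ k) X y) = inner ℂ u v ^ k * inner ℂ x (X y) := by
  induction k with
  | zero => simp
  | succ k ih => rw [pow_succ', Module.End.mul_apply, inner_conjSum_of_mem hx hy, ih]; ring

theorem inner_one_sub_conjSum_pow_of_mem {u v : Cn m} {x y : H} (hx : x ∈ jointKer T u)
    (hy : y ∈ jointKer T v) (X : H →L[ℂ] H) (k : ℕ) :
    inner ℂ x (((1 - conjSum T) ^ k) X y) = (1 - inner ℂ u v) ^ k * inner ℂ x (X y) := by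
  induction k with
  | zero => simp
  | succ k ih =>
    rw [pow_succ', Module.End.mul_apply, LinearMap.sub_apply, Module.End.one_apply, sub_apply,
      inner_sub_right, inner_conjSum_of_mem hx hy, ih]
    ring

theorem conjSum_isPositive {X : H →L[ℂ] H} (hX : X.IsPositive) : (conjSum T X).IsPositive := by
  rw [conjSum_apply]
  exact isPositive_sum _ fun i _ => hX.adjoint_conj (T i)

theorem conjSum_pow_isPositive {X : H →L[ℂ] H} (hX : X.IsPositive) (k : ℕ) :
    ((conjSum T ^ k) X).IsPositive := by
  induction k with
  | zero => simpa
  | succ k ih => rw [pow_succ', Module.End.mul_apply]; exact conjSum_isPositive ih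

theorem finiteDimensional_range_conjSum {X : H →L[ℂ] H}
    (hX : FiniteDimensional ℂ (LinearMap.range (X : H →ₗ[ℂ] H))) :
    FiniteDimensional ℂ (LinearMap.range (conjSum T X : H →ₗ[ℂ] H)) := by
  have : FiniteDimensional ℂ (⨆ i, (LinearMap.range (X : H →ₗ[ℂ] H)).map
      (adjoint (T i) : H →ₗ[ℂ] H) : Submodule ℂ H) := inferInstance
  refine Submodule.finiteDimensional_of_le (S₂ := ⨆ i, (LinearMap.range (X : H →ₗ[ℂ] H)).map
      (adjoint (T i) : H →ₗ[ℂ] H)) ?_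
  rintro _ ⟨x, rfl⟩
  simp only [conjSum_apply, ContinuousLinearMap.coe_coe, sum_apply]
  exact Submodule.sum_mem _ fun i _ => Submodule.mem_iSup_of_mem i ⟨X (T i x), ⟨T i x, rfl⟩, rfl⟩

theorem finiteDimensional_range_conjSum_pow {X : H →L[ℂ] H}
    (hX : FiniteDimensional ℂ (LinearMap.range (X : H →ₗ[ℂ] H))) (k : ℕ) :
    FiniteDimensional ℂ (LinearMap.range ((conjSum T ^ k) X : H →ₗ[ℂ] H)) := by
  induction k with
  | zero => simpa
  | succ k ih =>
    rw [pow_succ', Module.End.mul_apply]; exact finiteDimensional_range_conjSum ih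

end Eigenvectors

/-- `γ` is a section of the joint eigenspaces of `T` over the unit ball, with total range, whose
Gram function is `∑ a(i) ⟨v, u⟩ ^ i`. -/
structure IsPowerSection {m : ℕ} {H : Type*} [NormedAddCommGroup H] [InnerProductSpace ℂ H]
    (a : ℕ → ℝ) (T : Fin m → H →L[ℂ] H) (γ : Cn m → H) : Prop where
  hasSum_inner : ∀ u ∈ unitBall m, ∀ v ∈ unitBall m,
    HasSum (fun i : ℕ => (a i : ℂ) * inner ℂ u v ^ i) (inner ℂ (γ u) (γ v))
  dense : (Submodule.span ℂ (γ '' unitBall m)).topologicalClosure = ⊤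
  mem_jointKer : ∀ v ∈ unitBall m, γ v ∈ jointKer T v

/-- The operator `X` with `⟪γ u, X (γ v)⟫ = ⟪u, v⟫ ^ l` for a section `γ` of the joint eigenspaces
of `T`, normalized by `⟪γ u, γ 0⟫ = c`. -/
noncomputable def levelOp {m : ℕ} {H : Type*} [NormedAddCommGroup H] [InnerProductSpace ℂ H]
    [CompleteSpace H] (c : ℝ) (T : Fin m → H →L[ℂ] H) (γ : Cn m → H) (l : ℕ) : H →L[ℂ] H :=
  (((c ^ 2)⁻¹ : ℝ) : ℂ) • (conjSum T ^ l) (rankOne ℂ (γ 0) (γ 0))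

theorem levelOp_isPositive {m : ℕ} {H : Type*} [NormedAddCommGroup H] [InnerProductSpace ℂ H]
    [CompleteSpace H] (c : ℝ) (T : Fin m → H →L[ℂ] H) (γ : Cn m → H) (l : ℕ) :
    (levelOp c T γ l).IsPositive := by
  have := conjSum_pow_isPositive (T := T) (isPositive_rankOne_self (𝕜 := ℂ) (γ 0)) l
  exact this.smul_of_nonneg (Complex.zero_le_real.2 (inv_nonneg.2 (sq_nonneg c)))

theorem inner_self_eq_ofReal_norm_sq {H : Type*} [NormedAddCommGroup H] [InnerProductSpace ℂ H]
    (x : H) : inner ℂ x x = ((‖x‖ ^ 2 : ℝ) : ℂ) := by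
  rw [inner_self_eq_norm_sq_to_K]; norm_cast

theorem zero_mem_unitBall (m : ℕ) : (0 : Cn m) ∈ unitBall m := by simp

namespace IsPowerSection

variable {m : ℕ} {H : Type*} [NormedAddCommGroup H] [InnerProductSpace ℂ H]
  {a : ℕ → ℝ} {T : Fin m → H →L[ℂ] H} {γ : Cn m → H}

theorem inner_origin_right (hγ : IsPowerSection a T γ) {u : Cn m} (hu : u ∈ unitBall m) : inner ℂ (γ u) (γ 0) = a 0 := by
  refine (hγ.hasSum_inner u hu 0 (zero_mem_unitBall m)).unique ?_
  convert! hasSum_single 0 fun i hi => ?_ <;> simp_all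

theorem inner_origin_left (hγ : IsPowerSection a T γ) {u : Cn m} (hu : u ∈ unitBall m) : inner ℂ (γ 0) (γ u) = a 0 := by
  rw [← inner_conj_symm, hγ.inner_origin_right hu, Complex.conj_ofReal]

theorem hasSum_norm_sq (hγ : IsPowerSection a T γ) {u : Cn m} (hu : u ∈ unitBall m) :
    HasSum (fun i : ℕ => a i * (‖u‖ ^ 2) ^ i) (‖γ u‖ ^ 2) := by
  have h := hγ.hasSum_inner u hu u hu
  simp only [inner_self_eq_ofReal_norm_sq] at h
  exact Complex.hasSum_ofReal.1 (by push_cast at h ⊢; exact h)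

theorem ext_of_inner (hγ : IsPowerSection a T γ) {x y : H} (h : ∀ u ∈ unitBall m, inner ℂ (γ u) x = inner ℂ (γ u) y) :
    x = y := by
  have hd : Dense (Submodule.span ℂ (γ '' unitBall m) : Set H) :=
    Submodule.dense_iff_topologicalClosure_eq_top.2 hγ.dense
  refine hd.eq_of_inner_right ℂ fun z hz => ?_
  induction hz using Submodule.span_induction with
  | mem z hz => obtain ⟨u, hu, rfl⟩ := hz; exact h u hu
  | zero => simp
  | add x y _ _ hx hy => simp [inner_add_left, hx, hy]
  | smul c x _ hx => simp [inner_smul_left, hx]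

theorem ext_of_apply (hγ : IsPowerSection a T γ) {H₁ : Type*} [NormedAddCommGroup H₁] [InnerProductSpace ℂ H₁]
    {X Y : H →L[ℂ] H₁} (h : ∀ u ∈ unitBall m, X (γ u) = Y (γ u)) : X = Y := by
  refine ContinuousLinearMap.ext_on (s := γ '' unitBall m)
    (Submodule.dense_iff_topologicalClosure_eq_top.2 hγ.dense) ?_
  rintro _ ⟨u, hu, rfl⟩
  exact h u hu

variable [CompleteSpace H]

/-- The vector `γ 0` pairs to the constant `a 0` with every `γ u`, so its rank one operator has
constant matrix `(a 0)²`; each `conjSum` contributes a factor `⟨v, u⟩`. -/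
theorem inner_levelOp (hγ : IsPowerSection a T γ) (ha : 0 < a 0) (l : ℕ) {u v : Cn m} (hu : u ∈ unitBall m)
    (hv : v ∈ unitBall m) : inner ℂ (γ u) (levelOp (a 0) T γ l (γ v)) = inner ℂ u v ^ l := by
  have h : (a 0 : ℂ) ≠ 0 := Complex.ofReal_ne_zero.2 ha.ne'
  rw [levelOp, smul_apply, inner_smul_right,
    inner_conjSum_pow_of_mem (hγ.mem_jointKer u hu) (hγ.mem_jointKer v hv), rankOne_apply,
    inner_smul_right, hγ.inner_origin_left hv, hγ.inner_origin_right hu]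
  push_cast
  rw [mul_comm (a 0 : ℂ), mul_comm, mul_assoc, ← sq, mul_inv_cancel₀ (pow_ne_zero 2 h), mul_one]

/-- By sesquilinearity, `X = ∑ d(l) levelOp l` holds weakly on the dense span; with all `d(l) ≥ 0`,
positivity of the level operators passes to `X`. -/
theorem hasSum_inner_of_mem_span (hγ : IsPowerSection a T γ) (ha : 0 < a 0) {d : ℕ → ℝ} {X : H →L[ℂ] H}
    (hX : ∀ u ∈ unitBall m, ∀ v ∈ unitBall m,
      HasSum (fun l : ℕ => (d l : ℂ) * inner ℂ u v ^ l) (inner ℂ (γ u) (X (γ v)))) {x y : H}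
    (hx : x ∈ Submodule.span ℂ (γ '' unitBall m)) (hy : y ∈ Submodule.span ℂ (γ '' unitBall m)) :
    HasSum (fun l : ℕ => (d l : ℂ) * inner ℂ x (levelOp (a 0) T γ l y)) (inner ℂ x (X y)) := by
  induction hx, hy using Submodule.span_induction₂ with
  | mem_mem x y hx hy =>
    obtain ⟨u, hu, rfl⟩ := hx
    obtain ⟨v, hv, rfl⟩ := hy
    simpa only [hγ.inner_levelOp ha _ hu hv] using hX u hu v hv
  | zero_left => simp
  | zero_right => simp
  | add_left x y z _ _ _ h1 h2 => simpa only [inner_add_left, mul_add] using h1.add h2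
  | add_right x y z _ _ _ h1 h2 => simpa only [inner_add_right, map_add, mul_add] using h1.add h2
  | smul_left c x y _ _ h =>
    simpa only [inner_smul_left, mul_left_comm] using h.mul_left (conj c)
  | smul_right c x y _ _ h =>
    simpa only [inner_smul_right, map_smul, mul_left_comm] using h.mul_left c

theorem hasSum_re_inner_of_mem_span (hγ : IsPowerSection a T γ) (ha : 0 < a 0) {d : ℕ → ℝ} {X : H →L[ℂ] H}
    (hX : ∀ u ∈ unitBall m, ∀ v ∈ unitBall m,
      HasSum (fun l : ℕ => (d l : ℂ) * inner ℂ u v ^ l) (inner ℂ (γ u) (X (γ v)))) {x : H}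
    (hx : x ∈ Submodule.span ℂ (γ '' unitBall m)) :
    HasSum (fun l : ℕ => d l * (inner ℂ x (levelOp (a 0) T γ l x)).re) (inner ℂ x (X x)).re := by
  simpa using Complex.hasSum_re (hγ.hasSum_inner_of_mem_span ha hX hx hx)

/-- Positivity of an operator whose matrix with respect to the section is a power series with
nonnegative coefficients. -/
theorem re_inner_nonneg (hγ : IsPowerSection a T γ) (ha : 0 < a 0) {d : ℕ → ℝ} (hd : ∀ l, 0 ≤ d l) {X : H →L[ℂ] H}
    (hX : ∀ u ∈ unitBall m, ∀ v ∈ unitBall m,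
      HasSum (fun l : ℕ => (d l : ℂ) * inner ℂ u v ^ l) (inner ℂ (γ u) (X (γ v)))) (x : H) :
    0 ≤ (inner ℂ x (X x)).re := by
  have hc : IsClosed {x : H | 0 ≤ (inner ℂ x (X x)).re} :=
    isClosed_le continuous_const (by fun_prop)
  have hs : (Submodule.span ℂ (γ '' unitBall m) : Set H) ⊆ {x : H | 0 ≤ (inner ℂ x (X x)).re} :=
    fun y hy => (hγ.hasSum_re_inner_of_mem_span ha hX hy).nonneg fun l =>
      mul_nonneg (hd l) ((levelOp_isPositive (a 0) T γ l).re_inner_nonneg_right y)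
  have hx : x ∈ closure (Submodule.span ℂ (γ '' unitBall m) : Set H) :=
    Submodule.dense_iff_topologicalClosure_eq_top.2 hγ.dense x
  exact hc.closure_subset_iff.2 hs hx

/-- Write `P` for the level operator. Deleting the coefficient of degree `l` from the Gram series
shows `a(l) P ≤ 1`. Positivity of `P` at `x - a(l) P x`, combined with this bound at `P x`, gives
`a(l) P² ≤ P`. -/
theorem norm_levelOp_sq_le (hγ : IsPowerSection a T γ) (ha : ∀ l, 0 < a l) (l : ℕ) (x : H) :
    a l * ‖levelOp (a 0) T γ l x‖ ^ 2 ≤ (inner ℂ x (levelOp (a 0) T γ l x)).re := by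
  set P := levelOp (a 0) T γ l with hP
  have hPpos : P.IsPositive := levelOp_isPositive (a 0) T γ l
  have hle : ∀ y, a l * (inner ℂ y (P y)).re ≤ ‖y‖ ^ 2 := fun y => by
    have h := hγ.re_inner_nonneg (ha 0) (d := fun i => if i = l then 0 else a i)
      (X := 1 - (a l : ℂ) • P) (fun i => by split_ifs; exacts [le_rfl, (ha i).le])
      (fun u hu v hv => ?_) y
    · simpa [inner_sub_right, inner_smul_right, inner_self_eq_ofReal_norm_sq, ← Complex.ofReal_pow]
        using h
    · have h1 := (hγ.hasSum_inner u hu v hv).sub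
        (hasSum_ite_eq l ((a l : ℂ) * inner ℂ u v ^ l))
      rw [← hγ.inner_levelOp (ha 0) l hu hv, ← inner_smul_right, ← inner_sub_right] at h1
      convert! h1 using 2 with i
      split_ifs with h
      · rw [inner_smul_right, hγ.inner_levelOp (ha 0) l hu hv, h]; simp
      · simp
  have hsym : ∀ y z, inner ℂ (P y) z = inner ℂ y (P z) := fun y z => by
    rw [← adjoint_inner_right, hPpos.isSelfAdjoint.adjoint_eq]
  have h1 := hPpos.re_inner_nonneg_right (x - (a l : ℂ) • P x)
  have h2 := hle (P x)
  have hal := ha l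
  simp only [map_sub, map_smul, inner_sub_right, inner_sub_left, inner_smul_left, inner_smul_right,
    ← hsym x, Complex.conj_ofReal, inner_self_eq_ofReal_norm_sq] at h1
  rw [hsym x x] at h1
  simp [-map_mul, -Complex.ofReal_pow] at h1
  nlinarith [mul_le_mul_of_nonneg_left h2 hal.le]

end IsPowerSection

end CDTuple

/-! ### Holomorphy of the section. -/

namespace CDTuple

open Metric Set Filter Topology InnerProductSpace

theorem differentiable_sum_smul_pow_apply {m : ℕ} {H : Type*} [NormedAddCommGroup H]
    [NormedSpace ℂ H] (B : Fin m → H →L[ℂ] H) (x : H) (l : ℕ) :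
    Differentiable ℂ fun v : Cn m => ((∑ j, v j • B j) ^ l) x := by
  induction l with
  | zero => simp
  | succ l ih =>
    have h : (fun v : Cn m => ((∑ j, v j • B j) ^ (l + 1)) x) =
        fun v => ∑ j, v j • B j (((∑ j, v j • B j) ^ l) x) := by
      ext v
      simp [pow_succ', sum_apply]
    rw [h]
    exact Differentiable.fun_sum fun j _ => Differentiable.fun_smul (by fun_prop)
      ((B j).differentiable.comp ih)

namespace IsPowerSection

variable {m : ℕ} {H : Type*} [NormedAddCommGroup H] [InnerProductSpace ℂ H]
  {a : ℕ → ℝ} {T : Fin m → H →L[ℂ] H} {γ : Cn m → H}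

theorem summable_coeff (hγ : IsPowerSection a T γ) (hm : 1 ≤ m) {t : ℝ} (ht0 : 0 ≤ t)
    (ht1 : t < 1) : Summable fun l => a l * t ^ l := by
  have hn : ‖EuclideanSpace.single (⟨0, hm⟩ : Fin m) ((√t : ℝ) : ℂ)‖ = √t := by
    simp [abs_of_nonneg]
  have hu : EuclideanSpace.single (⟨0, hm⟩ : Fin m) ((√t : ℝ) : ℂ) ∈ unitBall m := by
    rw [mem_ball_zero_iff, hn, Real.sqrt_lt' one_pos]; simpa
  have h := (hγ.hasSum_norm_sq hu).summable
  rwa [hn, Real.sq_sqrt ht0] at h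

variable [CompleteSpace H]

theorem inner_sum_adjoint_pow (hγ : IsPowerSection a T γ) {u : Cn m} (hu : u ∈ unitBall m)
    (v : Cn m) (l : ℕ) :
    inner ℂ (γ u) (((∑ j, v j • adjoint (T j)) ^ l) (γ 0)) = a 0 * inner ℂ u v ^ l := by
  induction l with
  | zero => simp [hγ.inner_origin_right hu]
  | succ l ih =>
    have h := mem_jointKer_iff.1 (hγ.mem_jointKer u hu)
    rw [pow_succ', mul_apply_eq_comp, sum_apply, inner_sum]
    simp only [smul_apply, inner_smul_right, adjoint_inner_right, h, inner_smul_left, ih,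
      PiLp.inner_apply, RCLike.inner_apply, pow_succ, Finset.mul_sum]
    exact Finset.sum_congr rfl fun i _ => by ring

/-- The degree `l` component of `γ v` is a polynomial in `v`, obtained by applying the adjoints of
the tuple to `γ 0`. -/
theorem smul_levelOp_apply (hγ : IsPowerSection a T γ) (ha : 0 < a 0) {v : Cn m}
    (hv : v ∈ unitBall m) (l : ℕ) :
    (a l : ℂ) • levelOp (a 0) T γ l (γ v) =
      ((a l / a 0 : ℝ) : ℂ) • ((∑ j, v j • adjoint (T j)) ^ l) (γ 0) := by
  have h : (a 0 : ℂ) ≠ 0 := Complex.ofReal_ne_zero.2 ha.ne'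
  refine hγ.ext_of_inner fun u hu => ?_
  rw [inner_smul_right, inner_smul_right, hγ.inner_levelOp ha l hu hv,
    hγ.inner_sum_adjoint_pow hu, Complex.ofReal_div, ← mul_assoc, div_mul_cancel₀ _ h]

theorem norm_smul_levelOp_apply_le (hγ : IsPowerSection a T γ) (ha : ∀ l, 0 < a l) {v : Cn m}
    (hv : v ∈ unitBall m) (l : ℕ) :
    ‖(a l : ℂ) • levelOp (a 0) T γ l (γ v)‖ ≤ √(a l) * ‖v‖ ^ l := by
  have h := hγ.norm_levelOp_sq_le ha l (γ v)
  rw [hγ.inner_levelOp (ha 0) l hv hv, inner_self_eq_ofReal_norm_sq, ← Complex.ofReal_pow,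
    Complex.ofReal_re] at h
  refine abs_le_of_sq_le_sq' ?_ (by positivity) |>.2
  rw [norm_smul, Complex.norm_real, Real.norm_of_nonneg (ha l).le, mul_pow, mul_pow,
    Real.sq_sqrt (ha l).le, ← pow_mul, mul_comm l, pow_mul]
  nlinarith [mul_le_mul_of_nonneg_left h (ha l).le]

theorem tsum_levelOp (hγ : IsPowerSection a T γ) (ha : ∀ l, 0 < a l) {v : Cn m}
    (hv : v ∈ unitBall m) (hs : Summable fun l => (a l : ℂ) • levelOp (a 0) T γ l (γ v)) :
    ∑' l, (a l : ℂ) • levelOp (a 0) T γ l (γ v) = γ v := by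
  refine hγ.ext_of_inner fun u hu => ?_
  have h := hs.hasSum.mapL (innerSL ℂ (γ u))
  simp only [innerSL_apply_apply, inner_smul_right, hγ.inner_levelOp (ha 0) _ hu hv] at h
  exact h.unique (hγ.hasSum_inner u hu v hv)

/-- A section with power series Gram function is holomorphic. -/
theorem differentiableOn (hγ : IsPowerSection a T γ) (hm : 1 ≤ m) (ha : ∀ l, 0 < a l) :
    DifferentiableOn ℂ γ (unitBall m) := by
  intro x hx
  rw [mem_ball_zero_iff] at hx
  obtain ⟨R, hxR, hR1⟩ := exists_between hx
  obtain ⟨R', hRR', hR'1⟩ := exists_between hR1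
  have hR0 : 0 < R := (norm_nonneg x).trans_lt hxR
  have hR'0 : 0 < R' := hR0.trans hRR'
  have hsub : ball x (R - ‖x‖) ⊆ ball 0 R := ball_subset_ball' (by simp)
  have hsub1 : ball (0 : Cn m) R ⊆ unitBall m := ball_subset_ball hR1.le
  set u : ℕ → ℝ := fun l => √(a l) * R ^ l with hu_def
  -- With `R < R' < 1`, the product `√(a l) R^l = (√(a l) R'^l) (R / R')^l` is at most `a(l) R'^(2l)
  -- + (R / R')^(2l)`, a sum of two convergent series.
  have hu : Summable u := by
    have h1 := hγ.summable_coeff hm (sq_nonneg R') (by nlinarith)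
    have h2 : Summable fun l => ((R / R') ^ 2) ^ l :=
      summable_geometric_of_lt_one (by positivity)
        (pow_lt_one₀ (by positivity) ((div_lt_one hR'0).2 hRR') two_ne_zero)
    refine Summable.of_nonneg_of_le (fun l => by positivity) (fun l => ?_) (h1.add h2)
    have h3 : √(a l) * R ^ l = (√(a l) * R' ^ l) * (R / R') ^ l := by
      rw [div_pow]; field_simp
    have h4 : (√(a l) * R' ^ l) ^ 2 = a l * (R' ^ 2) ^ l := by
      rw [mul_pow, Real.sq_sqrt (ha l).le]; ring
    have h5 : ((R / R') ^ l) ^ 2 = ((R / R') ^ 2) ^ l := by ring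
    simp only [hu_def]
    rw [h3, ← h4, ← h5]
    nlinarith [sq_nonneg (√(a l) * R' ^ l - (R / R') ^ l), sq_nonneg (√(a l) * R' ^ l),
      sq_nonneg ((R / R') ^ l)]
  obtain ⟨q, hq⟩ : ∃ q : ℕ → Cn m → H, ∀ l v,
      q l v = ((a l / a 0 : ℝ) : ℂ) • ((∑ j, v j • adjoint (T j)) ^ l) (γ 0) :=
    ⟨_, fun _ _ => rfl⟩
  have hqd : ∀ l, Differentiable ℂ (q l) := fun l => by
    rw [funext (hq l)]
    exact (differentiable_sum_smul_pow_apply _ _ l).const_smul _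
  have hqγ : ∀ v ∈ unitBall m, ∀ l, (a l : ℂ) • levelOp (a 0) T γ l (γ v) = q l v :=
    fun v hv l => by rw [hq, hγ.smul_levelOp_apply (ha 0) hv]
  have hbound : ∀ l, ∀ v ∈ ball (0 : Cn m) R, ‖q l v‖ ≤ u l := fun l v hv => by
    rw [← hqγ v (hsub1 hv)]
    refine (hγ.norm_smul_levelOp_apply_le ha (hsub1 hv) l).trans ?_
    have := (mem_ball_zero_iff.1 hv).le
    simp only [hu_def]
    gcongr
  refine DifferentiableAt.differentiableWithinAt ?_
  refine (differentiableAt_tsum_of_norm_le_ball (sub_pos.2 hxR) hu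
    (fun l => (hqd l).differentiableOn)
    fun l v hv => hbound l v (hsub hv)).congr_of_eventuallyEq ?_
  filter_upwards [ball_mem_nhds x (sub_pos.2 hxR)] with v hv
  have hv1 := hqγ v (hsub1 (hsub hv))
  have h := hγ.tsum_levelOp ha (hsub1 (hsub hv))
  simp only [hv1] at h
  exact (h (Summable.of_norm_bounded hu fun l => hbound l v (hsub hv))).symm

end IsPowerSection

end CDTuple

/-! ### Backward differences and partial sums of coefficients. -/

/-- The sequence of the backward differences of `a`, with `a (-1) = 0`. -/
def backDiff (a : ℕ → ℝ) : ℕ → ℝ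
  | 0 => a 0
  | i + 1 => a (i + 1) - a i

/-- The sequence of the partial sums of `u`. -/
def partialSum (u : ℕ → ℝ) (i : ℕ) : ℝ := ∑ j ∈ Finset.range (i + 1), u j

theorem partialSum_backDiff : Function.LeftInverse partialSum backDiff := by
  intro a
  ext i
  induction i with
  | zero => simp [partialSum, backDiff]
  | succ i ih =>
    rw [partialSum, Finset.sum_range_succ, ← partialSum, ih]
    simp [backDiff]

/-- Multiplying a generating function by `1 - x` takes backward differences of its coefficients. -/
theorem hasSum_backDiff {a : ℕ → ℝ} {x s : ℂ} (h : HasSum (fun i => (a i : ℂ) * x ^ i) s) :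
    HasSum (fun i => (backDiff a i : ℂ) * x ^ i) ((1 - x) * s) := by
  rw [← hasSum_nat_add_iff' 1] at h ⊢
  have h0 := ((hasSum_nat_add_iff' 1).1 h).mul_left x
  convert! h.sub h0 using 1
  · ext i
    simp [backDiff]; ring
  · simp [backDiff]; ring

theorem hasSum_backDiff_iterate {a : ℕ → ℝ} {x s : ℂ}
    (h : HasSum (fun i => (a i : ℂ) * x ^ i) s) (n : ℕ) :
    HasSum (fun i => (backDiff^[n] a i : ℂ) * x ^ i) ((1 - x) ^ n * s) := by
  induction n with
  | zero => simpa using h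
  | succ n ih =>
    rw [Function.iterate_succ_apply', pow_succ', mul_assoc]
    exact hasSum_backDiff ih

theorem backDiff_iterate_zero (a : ℕ → ℝ) (n : ℕ) : backDiff^[n] a 0 = a 0 := by
  induction n with
  | zero => rfl
  | succ n ih => rw [Function.iterate_succ_apply', backDiff, ih]

theorem partialSum_mono {u v : ℕ → ℝ} (h : ∀ i, u i ≤ v i) (i : ℕ) :
    partialSum u i ≤ partialSum v i :=
  Finset.sum_le_sum fun j _ => h j

theorem partialSum_const_mul_choose (C : ℝ) (k i : ℕ) :
    partialSum (fun i => C * ((i + k).choose k : ℝ)) i = C * ((i + (k + 1)).choose (k + 1) : ℝ) := by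
  rw [partialSum, ← Finset.mul_sum]
  exact_mod_cast congrArg (fun t : ℕ => C * (t : ℝ)) (Nat.sum_range_add_choose i k)

/-- The first summation uses `hC`; each of the other `k` sums binomial coefficients by the
hockey-stick identity. -/
theorem partialSum_iterate_le {c : ℕ → ℝ} {C : ℝ} (hC : ∀ i, partialSum c i ≤ C) (k i : ℕ) :
    partialSum^[k + 1] c i ≤ C * ((i + k).choose k : ℝ) := by
  induction k generalizing i with
  | zero => simpa using hC i
  | succ k ih =>
    rw [Function.iterate_succ_apply', ← partialSum_const_mul_choose]
    exact partialSum_mono ih i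

/-- Here the first summation keeps only the term `c 0`. -/
theorem le_partialSum_iterate {c : ℕ → ℝ} (hc : ∀ i, 0 ≤ c i) (k i : ℕ) :
    c 0 * ((i + k).choose k : ℝ) ≤ partialSum^[k + 1] c i := by
  induction k generalizing i with
  | zero =>
    simpa [partialSum] using
      Finset.single_le_sum (f := c) (fun j _ => hc j) (Finset.mem_range.2 (Nat.succ_pos i))
  | succ k ih =>
    rw [Function.iterate_succ_apply', ← partialSum_const_mul_choose]
    exact partialSum_mono ih i

/-! ### Comparable Gram functions give similar tuples. -/

namespace CDTuple

open Metric Set Filter Topology InnerProductSpace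

namespace IsPowerSection

section Comparison

variable {m : ℕ} {H : Type*} [NormedAddCommGroup H] [InnerProductSpace ℂ H]
  {a : ℕ → ℝ} {T : Fin m → H →L[ℂ] H} {γ : Cn m → H}
  {H' : Type*} [NormedAddCommGroup H'] [InnerProductSpace ℂ H']
  {b : ℕ → ℝ} {S : Fin m → H' →L[ℂ] H'} {γ' : Cn m → H'}

theorem linearCombination_mem_span (x : unitBall m →₀ ℂ) :
    Finsupp.linearCombination ℂ (fun u : unitBall m => γ u) x ∈
      Submodule.span ℂ (γ '' unitBall m) := by
  have h := LinearMap.mem_range_self (Finsupp.linearCombination ℂ fun u : unitBall m => γ u) x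
  rwa [Finsupp.range_linearCombination, ← image_eq_range] at h

theorem denseRange_linearCombination (hγ : IsPowerSection a T γ) :
    DenseRange (Finsupp.linearCombination ℂ fun u : unitBall m => γ u) := by
  have h := Submodule.dense_iff_topologicalClosure_eq_top.2 hγ.dense
  rw [image_eq_range, ← Finsupp.range_linearCombination] at h
  exact h

variable [CompleteSpace H] [CompleteSpace H']

/-- The right side involves only points and coefficients, not `γ`, so the level forms of two
sections agree on formal combinations of points. -/
theorem inner_levelOp_linearCombination (hγ : IsPowerSection a T γ) (ha : 0 < a 0) (l : ℕ)
    (x : unitBall m →₀ ℂ) :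
    inner ℂ (Finsupp.linearCombination ℂ (fun u : unitBall m => γ u) x)
      (levelOp (a 0) T γ l (Finsupp.linearCombination ℂ (fun u : unitBall m => γ u) x)) =
    x.sum fun u c => x.sum fun v d =>
      conj c * (d * inner ℂ (u : Cn m) (v : Cn m) ^ l) := by
  simp only [Finsupp.linearCombination_apply, map_finsuppSum, Finsupp.sum_inner, Finsupp.inner_sum,
    map_smul, inner_smul_left, inner_smul_right]
  simp only [hγ.inner_levelOp ha l (Subtype.coe_prop _) (Subtype.coe_prop _), Finsupp.mul_sum]
  rw [Finsupp.sum_comm]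
  simp only [mul_left_comm]

theorem hasSum_norm_sq_of_mem_span (hγ : IsPowerSection a T γ) (ha : 0 < a 0) {x : H}
    (hx : x ∈ Submodule.span ℂ (γ '' unitBall m)) :
    HasSum (fun l : ℕ => a l * (inner ℂ x (levelOp (a 0) T γ l x)).re) (‖x‖ ^ 2) := by
  have h := hγ.hasSum_re_inner_of_mem_span ha (X := 1) hγ.hasSum_inner hx
  rwa [one_apply_eq_self, inner_self_eq_ofReal_norm_sq, Complex.ofReal_re] at h

/-- Both squared norms expand in the same nonnegative level forms, with coefficients `b` and `a`;
compare term by term. -/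
theorem norm_linearCombination_sq_le (hγ : IsPowerSection a T γ) (hγ' : IsPowerSection b S γ')
    (ha : 0 < a 0) (hb : 0 < b 0) {C : ℝ} (h : ∀ l, b l ≤ C * a l) (x : unitBall m →₀ ℂ) :
    ‖Finsupp.linearCombination ℂ (fun u : unitBall m => γ' u) x‖ ^ 2 ≤
      C * ‖Finsupp.linearCombination ℂ (fun u : unitBall m => γ u) x‖ ^ 2 := by
  have h2 := hγ'.hasSum_norm_sq_of_mem_span hb (linearCombination_mem_span x)
  simp only [hγ'.inner_levelOp_linearCombination hb] at h2
  have h3 := (hγ.hasSum_norm_sq_of_mem_span ha (linearCombination_mem_span x)).mul_left C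
  refine hasSum_le (fun l => ?_) h2 h3
  rw [← hγ.inner_levelOp_linearCombination ha, ← mul_assoc]
  exact mul_le_mul_of_nonneg_right (h l)
    ((levelOp_isPositive (a 0) T γ l).re_inner_nonneg_right _)

/-- Tuples with comparable power series Gram functions are similar. -/
theorem similar (hγ : IsPowerSection a T γ) (hγ' : IsPowerSection b S γ')
    (ha : 0 < a 0) (hb : 0 < b 0) {C C' : ℝ} (h : ∀ l, b l ≤ C * a l) (h' : ∀ l, a l ≤ C' * b l) :
    Similar T S := by
  have key : ∀ (p q D : ℝ), 0 ≤ p → 0 ≤ q → p ^ 2 ≤ D * q ^ 2 → p ≤ √D * q :=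
    fun p q D hp hq hpq => by
      calc p ≤ √(D * q ^ 2) := Real.le_sqrt_of_sq_le hpq
        _ = √D * q := by rw [Real.sqrt_mul' _ (sq_nonneg q), Real.sqrt_sq hq]
  have hd1 := hγ.denseRange_linearCombination
  have hd2 := hγ'.denseRange_linearCombination
  have hn1 : ∃ D, ∀ x : unitBall m →₀ ℂ,
      ‖Finsupp.linearCombination ℂ (fun u : unitBall m => γ' u) (LinearEquiv.refl ℂ _ x)‖ ≤
        D * ‖Finsupp.linearCombination ℂ (fun u : unitBall m => γ u) x‖ :=
    ⟨√C, fun x => key _ _ _ (norm_nonneg _) (norm_nonneg _)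
      (hγ.norm_linearCombination_sq_le hγ' ha hb h x)⟩
  have hn2 : ∃ D, ∀ x : unitBall m →₀ ℂ,
      ‖Finsupp.linearCombination ℂ (fun u : unitBall m => γ u)
        ((LinearEquiv.refl ℂ (unitBall m →₀ ℂ)).symm x)‖ ≤
        D * ‖Finsupp.linearCombination ℂ (fun u : unitBall m => γ' u) x‖ :=
    ⟨√C', fun x => key _ _ _ (norm_nonneg _) (norm_nonneg _)
      (hγ'.norm_linearCombination_sq_le hγ hb ha h' x)⟩
  -- The map `γ u ↦ γ' u` on formal combinations, extended by density; the two bounds make it and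
  -- its inverse continuous.
  set X : H ≃L[ℂ] H' := LinearEquiv.extend (LinearEquiv.refl ℂ (unitBall m →₀ ℂ)) _ _
    hd1 hn1 hd2 hn2 with hXdef
  have hX : ∀ u ∈ unitBall m, X (γ u) = γ' u := fun u hu => by
    have := LinearEquiv.extend_eq (LinearEquiv.refl ℂ (unitBall m →₀ ℂ)) _ _ hd1 hn1 hd2 hn2
      (Finsupp.single ⟨u, hu⟩ 1)
    simpa using this
  refine ⟨X, fun i x => ?_⟩
  have h1 : (X : H →L[ℂ] H') ∘L T i = S i ∘L (X : H →L[ℂ] H') := by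
    refine hγ.ext_of_apply fun u hu => ?_
    have h2 := mem_jointKer_iff.1 (hγ.mem_jointKer u hu) i
    have h3 := mem_jointKer_iff.1 (hγ'.mem_jointKer u hu) i
    simp [h2, h3, hX u hu]
  exact congrArg (fun Y : H →L[ℂ] H' => Y x) h1

end Comparison

end IsPowerSection

end CDTuple

/-! ### Positive operators have nonnegative coefficients. -/

namespace CDTuple

open Metric Set Filter Topology InnerProductSpace

theorem sum_range_pow_conj_pow_mul_pow {N : ℕ} {ζ : ℂ} (hζ : IsPrimitiveRoot ζ N) {i l : ℕ}
    (hi : i < N) (hl : l < N) :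
    ∑ k ∈ Finset.range N, (conj ζ ^ i) ^ k * (ζ ^ l) ^ k = if l = i then (N : ℂ) else 0 := by
  have hn : conj ζ * ζ = 1 := by
    rw [mul_comm, Complex.mul_conj, Complex.normSq_eq_norm_sq, hζ.norm'_eq_one (by omega)]; simp
  simp_rw [← mul_pow]
  split_ifs with h
  · rw [h, ← mul_pow, hn]; simp
  · have hne : conj ζ ^ i * ζ ^ l ≠ 1 := fun h1 => h (hζ.pow_inj hl hi (by
      calc ζ ^ l = (conj ζ * ζ) ^ i * ζ ^ l := by rw [hn]; simp
        _ = (conj ζ ^ i * ζ ^ l) * ζ ^ i := by rw [mul_pow]; ring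
        _ = ζ ^ i := by rw [h1, one_mul]))
    rw [geom_sum_eq hne, mul_pow, ← pow_mul, ← pow_mul, mul_comm i, mul_comm l, pow_mul, pow_mul,
      ← map_pow, hζ.pow_eq_one]
    simp

namespace IsPowerSection

variable {m : ℕ} {H : Type*} [NormedAddCommGroup H] [InnerProductSpace ℂ H] [CompleteSpace H]
  {a : ℕ → ℝ} {T : Fin m → H →L[ℂ] H} {γ : Cn m → H}

/-- Test positivity on combinations of `γ` at the points `r ζ^k` of one coordinate axis: there the
level form of degree `l` becomes `r^(2l)` times the square of an exponential sum. -/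
theorem hasSum_coeff_mul_norm_sq (hγ : IsPowerSection a T γ) (hm : 1 ≤ m) (ha : 0 < a 0)
    {d : ℕ → ℝ} {X : H →L[ℂ] H}
    (hX : ∀ u ∈ unitBall m, ∀ v ∈ unitBall m,
      HasSum (fun l : ℕ => (d l : ℂ) * inner ℂ u v ^ l) (inner ℂ (γ u) (X (γ v))))
    (hpos : X.IsPositive) {r : ℝ} (hr0 : 0 < r) (hr1 : r < 1) {N : ℕ} {ζ : ℂ} (hζ : ‖ζ‖ = 1)
    (α : ℕ → ℂ) :
    ∃ s : ℝ, 0 ≤ s ∧ HasSum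
      (fun l : ℕ => d l * (r ^ 2) ^ l * ‖∑ k ∈ Finset.range N, α k * (ζ ^ l) ^ k‖ ^ 2) s := by
  set p : ℕ → Cn m := fun k => EuclideanSpace.single (⟨0, hm⟩ : Fin m) ((r : ℂ) * ζ ^ k) with hp
  have hpmem : ∀ k, p k ∈ unitBall m := fun k => by
    rw [mem_ball_zero_iff]
    simpa [hp, hζ, abs_of_pos hr0] using hr1
  have hpp : ∀ j k, inner ℂ (p j) (p k) = (r ^ 2 : ℂ) * (conj (ζ ^ j) * ζ ^ k) := fun j k => by
    simp [hp, PiLp.inner_apply]; ring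
  set x : H := ∑ k ∈ Finset.range N, α k • γ (p k) with hx
  have hxs : x ∈ Submodule.span ℂ (γ '' unitBall m) :=
    Submodule.sum_mem _ fun k _ => Submodule.smul_mem _ _
      (Submodule.subset_span ⟨p k, hpmem k, rfl⟩)
  refine ⟨_, hpos.re_inner_nonneg_right x, ?_⟩
  convert! hγ.hasSum_re_inner_of_mem_span ha hX hxs using 2 with l
  rw [mul_assoc]
  congr 1
  have h1 : inner ℂ x (levelOp (a 0) T γ l x) = (r ^ 2 : ℂ) ^ l *
      (conj (∑ k ∈ Finset.range N, α k * (ζ ^ l) ^ k) *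
        ∑ k ∈ Finset.range N, α k * (ζ ^ l) ^ k) := by
    simp only [hx, sum_inner, map_sum, map_smul, inner_sum, inner_smul_left, inner_smul_right,
      hγ.inner_levelOp ha l (hpmem _) (hpmem _), hpp, Finset.sum_mul, Finset.mul_sum]
    refine Finset.sum_congr rfl fun j _ => Finset.sum_congr rfl fun k _ => ?_
    simp only [map_mul, map_pow, mul_pow]
    ring
  rw [h1, mul_comm (conj _), Complex.mul_conj, Complex.normSq_eq_norm_sq]
  norm_cast

/-- The coefficients of the power series of a positive operator are nonnegative. -/
theorem coeff_nonneg (hγ : IsPowerSection a T γ) (hm : 1 ≤ m) (ha : 0 < a 0)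
    {d : ℕ → ℝ} {X : H →L[ℂ] H}
    (hX : ∀ u ∈ unitBall m, ∀ v ∈ unitBall m,
      HasSum (fun l : ℕ => (d l : ℂ) * inner ℂ u v ^ l) (inner ℂ (γ u) (X (γ v))))
    (hpos : X.IsPositive) (i : ℕ) : 0 ≤ d i := by
  set t : ℝ := (1 / 2) ^ 2 with ht
  have hsum : Summable fun l => d l * t ^ l := by
    obtain ⟨s, -, hs⟩ := hγ.hasSum_coeff_mul_norm_sq hm ha hX hpos (r := 1 / 2) (by norm_num)
      (by norm_num) (N := 1) (ζ := 1) (by simp) (fun _ => 1)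
    simpa [ht] using hs.summable
  have habs : Summable fun l => |d l * t ^ l| := hsum.abs
  have htail : Tendsto (fun N => ∑' l, |d (l + N) * t ^ (l + N)|) atTop (𝓝 0) :=
    tendsto_sum_nat_add fun l => |d l * t ^ l|
  -- With `ζ` a primitive `N`-th root of unity and these weights, the exponential sum vanishes for
  -- every `l < N` except `l = i`, where it is `N`. The terms `l ≥ N` contribute at most `N²` times
  -- a tail of a convergent series; divide by `N²`, then let `N` tend to infinity.
  have hkey : ∀ N, i < N → -(d i * t ^ i) ≤ ∑' l, |d (l + N) * t ^ (l + N)| := by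
    intro N hN
    have hN0 : N ≠ 0 := by omega
    have hNpos : (0 : ℝ) < (N : ℝ) ^ 2 := by positivity
    have hζ := Complex.isPrimitiveRoot_exp N hN0
    have hζ1 := hζ.norm'_eq_one hN0
    set ζ := Complex.exp (2 * Real.pi * Complex.I / N)
    obtain ⟨s, hs0, hs⟩ := hγ.hasSum_coeff_mul_norm_sq hm ha hX hpos (r := 1 / 2) (by norm_num)
      (by norm_num) (N := N) hζ1 (fun k => (conj ζ ^ i) ^ k)
    set σ : ℕ → ℂ := fun l => ∑ k ∈ Finset.range N, (conj ζ ^ i) ^ k * (ζ ^ l) ^ k with hσ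
    have hσN : ∀ l, ‖σ l‖ ≤ N := fun l => by
      refine (norm_sum_le _ _).trans_eq ?_
      simp [hζ1]
    rw [← (hasSum_nat_add_iff' N)] at hs
    have hfin : ∑ l ∈ Finset.range N, d l * t ^ l * ‖σ l‖ ^ 2 = d i * t ^ i * (N : ℝ) ^ 2 := by
      rw [Finset.sum_eq_single_of_mem i (Finset.mem_range.2 hN)]
      · simp only [hσ]
        rw [sum_range_pow_conj_pow_mul_pow hζ hN hN]; simp
      · intro l hl hli
        simp only [hσ]
        rw [sum_range_pow_conj_pow_mul_pow hζ hN (Finset.mem_range.1 hl)]; simp [hli]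
    have h2 : s - d i * t ^ i * (N : ℝ) ^ 2 ≤
        (∑' l, |d (l + N) * t ^ (l + N)|) * (N : ℝ) ^ 2 := by
      rw [← hfin]
      refine hasSum_le (fun l => ?_) hs
        ((((summable_nat_add_iff N).2 habs).hasSum).mul_right ((N : ℝ) ^ 2))
      calc d (l + N) * t ^ (l + N) * ‖σ (l + N)‖ ^ 2
          ≤ |d (l + N) * t ^ (l + N)| * ‖σ (l + N)‖ ^ 2 := by gcongr; exact le_abs_self _
        _ ≤ _ := by gcongr; exact hσN _
    refine le_of_mul_le_mul_right ?_ hNpos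
    linarith
  have h0 : -(d i * t ^ i) ≤ 0 :=
    ge_of_tendsto htail ((eventually_gt_atTop i).mono fun N hN => hkey N hN)
  have : 0 < t ^ i := by positivity
  by_contra hneg
  nlinarith [mul_neg_of_neg_of_pos (not_le.1 hneg) this]

theorem hasSum_inner_one_sub_conjSum (hγ : IsPowerSection a T γ) (n : ℕ) {u v : Cn m}
    (hu : u ∈ unitBall m) (hv : v ∈ unitBall m) :
    HasSum (fun l : ℕ => (backDiff^[n] a l : ℂ) * inner ℂ u v ^ l)
      (inner ℂ (γ u) (((1 - conjSum T) ^ n) (1 : H →L[ℂ] H) (γ v))) := by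
  rw [inner_one_sub_conjSum_pow_of_mem (hγ.mem_jointKer u hu) (hγ.mem_jointKer v hv),
    one_apply_eq_self]
  exact hasSum_backDiff_iterate (hγ.hasSum_inner u hu v hv) n

/-- The weights of an `n`-hypercontraction have nonnegative differences of order `n`. -/
theorem backDiff_iterate_nonneg (hγ : IsPowerSection a T γ) (hm : 1 ≤ m) (ha : 0 < a 0) {n : ℕ}
    (hn : 1 ≤ n) (hT : IsHypercontraction n T) (i : ℕ) : 0 ≤ backDiff^[n] a i :=
  hγ.coeff_nonneg hm ha (fun _ hu _ hv => hγ.hasSum_inner_one_sub_conjSum n hu hv)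
    (hT n hn le_rfl) i

end IsPowerSection

end CDTuple

/-! ### Cowen–Douglas properties: closed range and one-dimensional kernels. -/

namespace CDTuple

open Metric Set Filter Topology InnerProductSpace

section ClosedRange

variable {m : ℕ} {H : Type*} [NormedAddCommGroup H] [InnerProductSpace ℂ H]

/-- A linear map which is bounded below on the kernel of a finite rank operator has closed range. -/
theorem isClosed_range_of_le_norm_of_finiteRank [CompleteSpace H] {G : Type*} [NormedAddCommGroup G]
    [NormedSpace ℂ G] {F : H →L[ℂ] H} (hF : FiniteDimensional ℂ (LinearMap.range (F : H →ₗ[ℂ] H)))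
    {D : H →L[ℂ] G} {c : ℝ} (hc : 0 < c) (h : ∀ x, F x = 0 → c * ‖x‖ ≤ ‖D x‖) :
    IsClosed (Set.range D) := by
  have hco : (LinearMap.ker (F : H →ₗ[ℂ] H)).CoFG :=
    Submodule.range_fg_iff_ker_cofg.1 (Module.finite_def.1 hF |> (Submodule.fg_top _).1)
  have hcl : IsClosed (LinearMap.ker (F : H →ₗ[ℂ] H) : Set H) := F.isClosed_ker
  have : CompleteSpace (LinearMap.ker (F : H →ₗ[ℂ] H)) := hcl.completeSpace_coe
  refine LinearMap.isClosed_range_of_isClosed_map_of_finiteDimensional_quotient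
    (f := (D : H →ₗ[ℂ] G)) (s := LinearMap.ker (F : H →ₗ[ℂ] H)) ?_
  set D' : LinearMap.ker (F : H →ₗ[ℂ] H) →L[ℂ] G := D ∘L Submodule.subtypeL _ with hD'
  have ha : AntilipschitzWith (Real.toNNReal c⁻¹) D' :=
    D'.antilipschitz_of_bound fun x => by
      rw [Real.coe_toNNReal _ (by positivity), inv_mul_eq_div, le_div_iff₀ hc, mul_comm]
      exact h x x.2
  convert! ha.isClosed_range D'.uniformContinuous using 1
  ext y
  simp [hD']

/-- `∑ ‖T i x‖² ≥ ρ² ‖x‖²` with `ρ > ‖w‖` bounds `T - w` from below. -/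
theorem norm_sub_smul_ge {T : Fin m → H →L[ℂ] H} {w : Cn m} {ρ : ℝ} {x : H}
    (hx : ρ ^ 2 * ‖x‖ ^ 2 ≤ ∑ i, ‖T i x‖ ^ 2) :
    (ρ - ‖w‖) * ‖x‖ ≤ ‖(WithLp.toLp 2 fun i => T i x - w i • x : PiLp 2 fun _ : Fin m => H)‖ := by
  set y : PiLp 2 fun _ : Fin m => H := WithLp.toLp 2 fun i => T i x with hy
  set z : PiLp 2 fun _ : Fin m => H := WithLp.toLp 2 fun i => w i • x with hz
  have hyn : ρ * ‖x‖ ≤ ‖y‖ := by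
    refine abs_le_of_sq_le_sq' ?_ (norm_nonneg _) |>.2
    rw [PiLp.norm_sq_eq_of_L2, mul_pow]
    exact hx
  have hzn : ‖z‖ = ‖w‖ * ‖x‖ := by
    rw [← sq_eq_sq₀ (norm_nonneg _) (by positivity), mul_pow, PiLp.norm_sq_eq_of_L2,
      EuclideanSpace.norm_sq_eq, Finset.sum_mul]
    simp [hz, norm_smul, mul_pow]
  have h : (WithLp.toLp 2 fun i => T i x - w i • x : PiLp 2 fun _ : Fin m => H) = y - z := rfl
  rw [h]
  linarith [norm_sub_norm_le y z]

/-- If `∑ T(i)* T(i)` is bounded below by a constant `ρ² > ‖w‖²` up to a finite rank operator, then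
`T - w` has closed range. -/
theorem isClosed_range_sub_smul [CompleteSpace H] {T : Fin m → H →L[ℂ] H} {w : Cn m} {ρ : ℝ} (hρ : ‖w‖ < ρ)
    {F : H →L[ℂ] H} (hF : FiniteDimensional ℂ (LinearMap.range (F : H →ₗ[ℂ] H)))
    (h : ∀ x, F x = 0 → ρ ^ 2 * ‖x‖ ^ 2 ≤ ∑ i, ‖T i x‖ ^ 2) :
    IsClosed (Set.range fun (x : H) (i : Fin m) => T i x - w i • x) := by
  -- The range lies in `Fin m → H` with its sup norm, while the lower bound holds in the `ℓ²` norm;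
  -- `‖L‖` converts between them, and `+ 1` keeps the denominator positive.
  set L : (Fin m → H) →L[ℂ] PiLp 2 fun _ : Fin m => H :=
    ((PiLp.continuousLinearEquiv 2 ℂ fun _ : Fin m => H).symm : (Fin m → H) →L[ℂ] PiLp 2 fun _ : Fin m => H)
  refine isClosed_range_of_le_norm_of_finiteRank
    (D := ContinuousLinearMap.pi fun i => T i - w i • (1 : H →L[ℂ] H)) hF
    (c := (ρ - ‖w‖) / (‖L‖ + 1)) (div_pos (sub_pos.2 hρ) (by positivity)) fun x hx => ?_
  have h1 := norm_sub_smul_ge (h x hx) (w := w)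
  have h2 := L.le_opNorm fun i => T i x - w i • x
  have h3 := h1.trans h2
  rw [div_mul_eq_mul_div, div_le_iff₀ (by positivity)]
  refine h3.trans ?_
  have h4 := norm_nonneg fun i => T i x - w i • x
  change _ ≤ ‖fun i => T i x - w i • x‖ * (‖L‖ + 1)
  nlinarith [norm_nonneg L]

end ClosedRange

namespace IsPowerSection

variable {m : ℕ} {H : Type*} [NormedAddCommGroup H] [InnerProductSpace ℂ H]
  {b : ℕ → ℝ} {S : Fin m → H →L[ℂ] H} {γ : Cn m → H}

theorem ne_zero (hγ : IsPowerSection b S γ) (hb : 0 < b 0) {u : Cn m} (hu : u ∈ unitBall m) :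
    γ u ≠ 0 := fun h => by
  have h1 := hγ.inner_origin_left hu
  rw [h, inner_zero_right] at h1
  exact hb.ne (by exact_mod_cast h1)

theorem commute (hγ : IsPowerSection b S γ) (i j : Fin m) : Commute (S i) (S j) := by
  refine hγ.ext_of_apply fun u hu => ?_
  have h := mem_jointKer_iff.1 (hγ.mem_jointKer u hu)
  simp [mul_apply_eq_comp, h, smul_smul, mul_comm]

theorem dense_iSup_jointKer (hγ : IsPowerSection b S γ) :
    (⨆ w ∈ unitBall m, jointKer S w).topologicalClosure = ⊤ := by
  rw [eq_top_iff, ← hγ.dense]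
  refine Submodule.topologicalClosure_mono (Submodule.span_le.2 ?_)
  rintro _ ⟨u, hu, rfl⟩
  exact Submodule.mem_iSup_of_mem u (Submodule.mem_iSup_of_mem hu (hγ.mem_jointKer u hu))

variable [CompleteSpace H]

/-- Both sides have all matrix entries equal to `1` along the section. -/
theorem one_sub_conjSum_pow_eq (hγ : IsPowerSection b S γ) {n : ℕ}
    (hker : ∀ u ∈ unitBall m, ∀ v ∈ unitBall m,
      (1 - inner ℂ u v) ^ n * inner ℂ (γ u) (γ v) = 1) (hb : b 0 = 1) :
    ((1 - conjSum S) ^ n) (1 : H →L[ℂ] H) = rankOne ℂ (γ 0) (γ 0) := by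
  refine hγ.ext_of_apply fun v hv => hγ.ext_of_inner fun u hu => ?_
  rw [inner_one_sub_conjSum_pow_of_mem (hγ.mem_jointKer u hu) (hγ.mem_jointKer v hv),
    one_apply_eq_self, hker u hu v hv, rankOne_apply, inner_smul_right, hγ.inner_origin_left hv,
    hγ.inner_origin_right hu, hb]
  simp

/-- An eigenvector `y` at `w` orthogonal to `γ 0` is killed by the defect operator `(1 - conjSum
S)^n 1`, whose form at `y` is `(1 - ‖w‖²)^n ‖y‖²`; hence `y = 0`. Subtracting a multiple of `γ w`
makes any eigenvector orthogonal to `γ 0`. -/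
theorem finrank_jointKer (hγ : IsPowerSection b S γ) {n : ℕ}
    (hker : ∀ u ∈ unitBall m, ∀ v ∈ unitBall m,
      (1 - inner ℂ u v) ^ n * inner ℂ (γ u) (γ v) = 1) (hb : b 0 = 1) {w : Cn m}
    (hw : w ∈ unitBall m) : Module.finrank ℂ (jointKer S w) = 1 := by
  have hb0 : 0 < b 0 := hb ▸ one_pos
  refine finrank_eq_one (⟨γ w, hγ.mem_jointKer w hw⟩ : jointKer S w)
    (fun h => hγ.ne_zero hb0 hw (congrArg Subtype.val h)) ?_
  rintro ⟨x, hx⟩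
  refine ⟨inner ℂ (γ 0) x, Subtype.ext ?_⟩
  set y := x - inner ℂ (γ 0) x • γ w with hy
  have hymem : y ∈ jointKer S w :=
    Submodule.sub_mem _ hx (Submodule.smul_mem _ _ (hγ.mem_jointKer w hw))
  have hy0 : inner ℂ (γ 0) y = 0 := by
    rw [hy, inner_sub_right, inner_smul_right, hγ.inner_origin_left hw, hb]; simp
  have h := inner_one_sub_conjSum_pow_of_mem hymem hymem (1 : H →L[ℂ] H) n
  rw [hγ.one_sub_conjSum_pow_eq hker hb, rankOne_apply, hy0, zero_smul, inner_zero_right,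
    one_apply_eq_self, inner_self_eq_ofReal_norm_sq, inner_self_eq_ofReal_norm_sq] at h
  have hw1 : ‖w‖ ^ 2 ≠ 1 := by
    have := mem_ball_zero_iff.1 hw
    nlinarith [norm_nonneg w]
  have h1 : ((1 : ℂ) - ((‖w‖ ^ 2 : ℝ) : ℂ)) ^ n ≠ 0 :=
    pow_ne_zero n (sub_ne_zero.2 fun h2 => hw1 (by exact_mod_cast h2.symm))
  have h3 := (mul_eq_zero.1 h.symm).resolve_left h1
  have h4 : y = 0 := by simpa using h3
  exact (sub_eq_zero.1 h4).symm

theorem finiteDimensional_range_sum_levelOp (c : ℝ) (d : ℕ → ℂ) (N : ℕ) :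
    FiniteDimensional ℂ (LinearMap.range
      ((∑ l ∈ Finset.range N, d l • levelOp c S γ l : H →L[ℂ] H) : H →ₗ[ℂ] H)) := by
  have h : ∀ l, FiniteDimensional ℂ (LinearMap.range
      ((conjSum S ^ l) (rankOne ℂ (γ 0) (γ 0)) : H →ₗ[ℂ] H)) := fun l => by
    refine finiteDimensional_range_conjSum_pow ?_ l
    refine Submodule.finiteDimensional_of_le (S₂ := Submodule.span ℂ {γ 0}) ?_
    rintro _ ⟨x, rfl⟩
    exact Submodule.smul_mem _ _ (Submodule.mem_span_singleton_self _)
  refine Submodule.finiteDimensional_of_le (S₂ := ⨆ l : Fin N, LinearMap.range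
      ((conjSum S ^ (l : ℕ)) (rankOne ℂ (γ 0) (γ 0)) : H →ₗ[ℂ] H)) ?_
  rintro _ ⟨x, rfl⟩
  rw [ContinuousLinearMap.coe_coe, sum_apply]
  refine Submodule.sum_mem _ fun l hl => ?_
  refine Submodule.smul_mem _ _ (Submodule.smul_mem _ _ ?_)
  exact Submodule.mem_iSup_of_mem ⟨l, Finset.mem_range.1 hl⟩ ⟨x, rfl⟩

/-- The operator `∑ S(i)* S(i)` shifts the coefficients, replacing `b(l)` by `b(l - 1)`. By `hlim`,
subtracting `ρ²` leaves nonnegative coefficients beyond degree `N`; the finite rank operator `F`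
repairs the degrees up to `N`. -/
theorem isClosed_range (hγ : IsPowerSection b S γ) (hb : ∀ l, 0 < b l)
    (hlim : ∀ δ < 1, ∃ N : ℕ, ∀ l, N ≤ l → δ * b (l + 1) ≤ b l) {w : Cn m}
    (hw : w ∈ unitBall m) :
    IsClosed (Set.range fun (x : H) (i : Fin m) => S i x - w i • x) := by
  rw [mem_ball_zero_iff] at hw
  obtain ⟨ρ, hwρ, hρ1⟩ := exists_between hw
  have hρ0 : 0 ≤ ρ := (norm_nonneg w).trans hwρ.le
  have hρ2 : ρ ^ 2 < 1 := pow_lt_one₀ hρ0 hρ1 two_ne_zero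
  obtain ⟨N, hN⟩ := hlim (ρ ^ 2) hρ2
  refine isClosed_range_sub_smul hwρ
    (finiteDimensional_range_sum_levelOp (S := S) (γ := γ) (b 0) (fun l => b l) (N + 1))
    fun x hx => ?_
  set F := ∑ l ∈ Finset.range (N + 1), (b l : ℂ) • levelOp (b 0) S γ l with hF
  have h := hγ.re_inner_nonneg (hb 0)
    (d := fun l => ((if l = 0 then 0 else b (l - 1)) - ρ ^ 2 * b l) +
      if l ∈ Finset.range (N + 1) then b l else 0)
    (X := (conjSum S 1 - ((ρ ^ 2 : ℝ) : ℂ) • 1) + F) (fun l => ?_) (fun u hu v hv => ?_) x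
  · rw [add_apply, hx, add_zero, sub_apply, inner_sub_right, inner_conjSum, smul_apply,
      inner_smul_right, Complex.sub_re, Complex.re_ofReal_mul] at h
    simp only [one_apply_eq_self, inner_self_eq_ofReal_norm_sq, ← Complex.ofReal_sum,
      Complex.ofReal_re] at h
    linarith
  · have hl := hb l
    rcases Nat.lt_or_ge l (N + 1) with h | h
    · rw [if_pos (Finset.mem_range.2 h)]
      have : 0 ≤ if l = 0 then 0 else b (l - 1) := by split_ifs; exacts [le_rfl, (hb _).le]
      nlinarith
    · obtain ⟨k, rfl⟩ : ∃ k, l = k + 1 := ⟨l - 1, by omega⟩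
      have := hN k (by omega)
      simp only [Nat.add_eq_zero_iff, one_ne_zero, and_false, if_false, Nat.add_sub_cancel,
        Finset.mem_range, not_lt.2 h]
      linarith
  · have h0 := hγ.hasSum_inner u hu v hv
    have h1 : HasSum (fun l : ℕ => (((if l = 0 then 0 else b (l - 1) : ℝ)) : ℂ) * inner ℂ u v ^ l)
        (inner ℂ u v * inner ℂ (γ u) (γ v)) := by
      rw [← hasSum_nat_add_iff' 1]
      convert! h0.mul_left (inner ℂ u v) using 1
      · ext l; simp; ring
      · simp
    have h2 : HasSum (fun l : ℕ => if l ∈ Finset.range (N + 1) then (b l : ℂ) * inner ℂ u v ^ l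
        else 0) (inner ℂ (γ u) (F (γ v))) := by
      have : inner ℂ (γ u) (F (γ v)) =
          ∑ l ∈ Finset.range (N + 1), if l ∈ Finset.range (N + 1) then
            (b l : ℂ) * inner ℂ u v ^ l else 0 := by
        rw [hF, sum_apply, inner_sum]
        refine Finset.sum_congr rfl fun l hl => ?_
        rw [if_pos hl, smul_apply, inner_smul_right, hγ.inner_levelOp (hb 0) l hu hv]
      rw [this]
      exact hasSum_sum_of_ne_finset_zero fun l hl => if_neg hl
    convert! (h1.sub (h0.mul_left ((ρ ^ 2 : ℝ) : ℂ))).add h2 using 1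
    · ext l
      split_ifs <;> push_cast <;> ring
    · rw [add_apply, inner_add_right, sub_apply, inner_sub_right, smul_apply, inner_smul_right,
        inner_conjSum_of_mem (hγ.mem_jointKer u hu) (hγ.mem_jointKer v hv)]
      simp

end IsPowerSection

end CDTuple

/-! ### Wirtinger calculus and the curvature of a power section. -/

namespace CDTuple

open Metric Set Filter Topology InnerProductSpace

section Wirtinger

variable {m : ℕ}

theorem dWbar_congr {f g : Cn m → ℂ} {w : Cn m} (h : f =ᶠ[𝓝 w] g) (j : Fin m) :
    dWbar j f w = dWbar j g w := by
  rw [dWbar, dWbar, h.fderiv_eq]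

theorem dW_congr {f g : Cn m → ℂ} {w : Cn m} (h : f =ᶠ[𝓝 w] g) (j : Fin m) :
    dW j f w = dW j g w := by
  rw [dW, dW, h.fderiv_eq]

theorem dWbar_add {f g : Cn m → ℂ} {w : Cn m} (hf : DifferentiableAt ℝ f w)
    (hg : DifferentiableAt ℝ g w) (j : Fin m) :
    dWbar j (f + g) w = dWbar j f w + dWbar j g w := by
  simp only [dWbar, fderiv_add hf hg, add_apply]; ring

theorem dW_add {f g : Cn m → ℂ} {w : Cn m} (hf : DifferentiableAt ℝ f w)
    (hg : DifferentiableAt ℝ g w) (j : Fin m) :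
    dW j (f + g) w = dW j f w + dW j g w := by
  simp only [dW, fderiv_add hf hg, add_apply]; ring

theorem dWbar_neg (f : Cn m → ℂ) (w : Cn m) (j : Fin m) : dWbar j (-f) w = -dWbar j f w := by
  simp only [dWbar, fderiv_neg, neg_apply]; ring

theorem dW_neg (f : Cn m → ℂ) (w : Cn m) (j : Fin m) : dW j (-f) w = -dW j f w := by
  simp only [dW, fderiv_neg, neg_apply]; ring

theorem fderiv_conj_apply (f : Cn m → ℂ) (w e : Cn m) :
    fderiv ℝ (fun v => conj (f v)) w e = conj (fderiv ℝ f w e) := by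
  have h := Complex.conjCLE.comp_fderiv (f := f) (x := w)
  have h2 : (fun v => conj (f v)) = Complex.conjCLE ∘ f := by ext v; simp
  rw [h2, h]; simp

theorem dWbar_conj (f : Cn m → ℂ) (w : Cn m) (j : Fin m) :
    dWbar j (fun v => conj (f v)) w = conj (dW j f w) := by
  simp [dWbar, dW, fderiv_conj_apply, Complex.conj_ofNat]

theorem dW_conj (f : Cn m → ℂ) (w : Cn m) (j : Fin m) :
    dW j (fun v => conj (f v)) w = conj (dWbar j f w) := by
  simp [dWbar, dW, fderiv_conj_apply, sub_eq_add_neg, Complex.conj_ofNat]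

theorem fderiv_real_single_I {f : Cn m → ℂ} {w : Cn m} (hf : DifferentiableAt ℂ f w)
    (j : Fin m) : fderiv ℝ f w (EuclideanSpace.single j Complex.I) =
      Complex.I * fderiv ℝ f w (EuclideanSpace.single j 1) := by
  have h : (EuclideanSpace.single j Complex.I : Cn m) =
      Complex.I • EuclideanSpace.single j (1 : ℂ) := by
    ext i; simp
  rw [hf.fderiv_restrictScalars ℝ, coe_restrictScalars', h, map_smul, smul_eq_mul]

theorem dWbar_of_differentiableAt {f : Cn m → ℂ} {w : Cn m} (hf : DifferentiableAt ℂ f w)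
    (j : Fin m) : dWbar j f w = 0 := by
  rw [dWbar, fderiv_real_single_I hf, ← mul_assoc, Complex.I_mul_I]; ring

theorem dW_of_differentiableAt {f : Cn m → ℂ} {w : Cn m} (hf : DifferentiableAt ℂ f w)
    (j : Fin m) : dW j f w = fderiv ℂ f w (EuclideanSpace.single j 1) := by
  rw [dW, fderiv_real_single_I hf, ← mul_assoc, Complex.I_mul_I, hf.fderiv_restrictScalars ℝ,
    coe_restrictScalars']
  ring

theorem differentiableAt_dWbar {f : Cn m → ℂ} {w : Cn m} (hf : ContDiffAt ℝ 2 f w)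
    (j : Fin m) : DifferentiableAt ℝ (dWbar j f) w := by
  have h : DifferentiableAt ℝ (fderiv ℝ f) w :=
    (hf.fderiv_right (m := 1) (by norm_num)).differentiableAt one_ne_zero
  unfold dWbar
  fun_prop

theorem complexHessian_congr {u v : Cn m → ℝ} {w : Cn m} (h : u =ᶠ[𝓝 w] v) :
    complexHessian u w = complexHessian v w := by
  ext i j
  refine dW_congr ?_ i
  filter_upwards [h.eventually_nhds] with x hx
  refine dWbar_congr ?_ j
  filter_upwards [hx] with y hy
  rw [hy]

theorem complexHessian_neg (u : Cn m → ℝ) (w : Cn m) :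
    complexHessian (-u) w = -complexHessian u w := by
  ext i j
  simp only [complexHessian, Matrix.of_apply, Matrix.neg_apply]
  rw [← dW_neg]
  refine congrArg (fun f => dW i f w) (funext fun x => ?_)
  rw [Pi.neg_apply, ← dWbar_neg]
  exact congrArg (fun f => dWbar j f x) (funext fun y => by simp)

theorem contDiffAt_ofReal_comp {u : Cn m → ℝ} {w : Cn m} (hu : ContDiffAt ℝ 2 u w) :
    ContDiffAt ℝ 2 (fun v => (u v : ℂ)) w :=
  Complex.ofRealCLM.contDiff.contDiffAt.comp w hu

theorem complexHessian_add {u v : Cn m → ℝ} {w : Cn m} (hu : ContDiffAt ℝ 2 u w)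
    (hv : ContDiffAt ℝ 2 v w) :
    complexHessian (u + v) w = complexHessian u w + complexHessian v w := by
  have hu' := contDiffAt_ofReal_comp hu
  have hv' := contDiffAt_ofReal_comp hv
  ext i j
  simp only [complexHessian, Matrix.of_apply, Matrix.add_apply]
  rw [← dW_add (differentiableAt_dWbar hu' j) (differentiableAt_dWbar hv' j)]
  refine dW_congr ?_ i
  filter_upwards [hu'.eventually (by simp), hv'.eventually (by simp)] with x hx hy
  rw [Pi.add_apply, ← dWbar_add (hx.differentiableAt two_ne_zero) (hy.differentiableAt two_ne_zero)]
  exact congrArg (fun f => dWbar j f x) (funext fun y => by simp)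

theorem complexHessian_sub {u v : Cn m → ℝ} {w : Cn m} (hu : ContDiffAt ℝ 2 u w)
    (hv : ContDiffAt ℝ 2 v w) :
    complexHessian (u - v) w = complexHessian u w - complexHessian v w := by
  rw [sub_eq_add_neg, sub_eq_add_neg, ← complexHessian_neg]
  exact complexHessian_add hu hv.neg

/-- Real parts of holomorphic functions are pluriharmonic. -/
theorem complexHessian_two_mul_re {F : Cn m → ℂ} {U : Set (Cn m)} (hU : IsOpen U)
    (hF : DifferentiableOn ℂ F U) {w : Cn m} (hw : w ∈ U) :
    complexHessian (fun v => 2 * (F v).re) w = 0 := by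
  ext i j
  have h1 : (fun x => dWbar j (fun v => ((2 * (F v).re : ℝ) : ℂ)) x) =ᶠ[𝓝 w]
      fun x => conj (fderiv ℂ F x (EuclideanSpace.single j 1)) := by
    filter_upwards [hU.mem_nhds hw] with x hx
    have hFx := hF.differentiableAt (hU.mem_nhds hx)
    have hFr : DifferentiableAt ℝ F x := hFx.restrictScalars ℝ
    have h2 : (fun v => ((2 * (F v).re : ℝ) : ℂ)) = F + fun v => conj (F v) := by
      ext v
      rw [Pi.add_apply, Complex.add_conj]
    have h3 : DifferentiableAt ℝ (fun v => conj (F v)) x :=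
      Complex.conjCLE.differentiableAt.comp x hFr
    rw [h2, dWbar_add hFr h3, dWbar_of_differentiableAt hFx, zero_add, dWbar_conj,
      dW_of_differentiableAt hFx]
  change dW i (fun x => dWbar j (fun v => ((2 * (F v).re : ℝ) : ℂ)) x) w = 0
  rw [dW_congr h1, dW_conj, dWbar_of_differentiableAt, map_zero]
  exact (hF.fderiv_apply_of_isOpen hU _).differentiableAt (hU.mem_nhds hw)

theorem contDiffAt_of_differentiableOn {G : Type*} [NormedAddCommGroup G] [NormedSpace ℂ G]
    [CompleteSpace G] {F : Cn m → G} {U : Set (Cn m)} (hU : IsOpen U)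
    (hF : DifferentiableOn ℂ F U) {w : Cn m} (hw : w ∈ U) : ContDiffAt ℝ 2 F w :=
  ((hF.contDiffOn_of_isOpen hU 2).contDiffAt (hU.mem_nhds hw)).restrict_scalars ℝ

/-- The logarithm of the modulus of a non-vanishing holomorphic function is locally the real part
of a holomorphic function. -/
theorem exists_log_norm_sq_eq {f : Cn m → ℂ} {U : Set (Cn m)} (hU : IsOpen U)
    (hf : DifferentiableOn ℂ f U) (hf0 : ∀ v ∈ U, f v ≠ 0) {w : Cn m} (hw : w ∈ U) :
    ∃ (F : Cn m → ℂ) (V : Set (Cn m)), IsOpen V ∧ w ∈ V ∧ DifferentiableOn ℂ F V ∧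
      ∀ v ∈ V, Real.log (‖f v‖ ^ 2) = 2 * (F v).re := by
  have hw0 := hf0 w hw
  have hc : ContinuousOn (fun v => f v / f w) U := hf.continuousOn.div_const _
  -- Dividing by `f w` moves the value at `w` to `1`, inside the slit plane; the real constant
  -- restores the modulus.
  refine ⟨fun v => Complex.log (f v / f w) + (Real.log ‖f w‖ : ℂ),
    U ∩ (fun v => f v / f w) ⁻¹' Complex.slitPlane,
    hc.isOpen_inter_preimage hU Complex.isOpen_slitPlane, ⟨hw, ?_⟩, ?_, ?_⟩
  · simp [hw0, Complex.one_mem_slitPlane]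
  · refine DifferentiableOn.add_const _ (DifferentiableOn.clog ?_ fun v hv => hv.2)
    simp only [div_eq_mul_inv]
    exact (hf.mono inter_subset_left).mul_const _
  · rintro v ⟨hv, -⟩
    rw [Complex.add_re, Complex.log_re, Complex.ofReal_re, norm_div,
      Real.log_div (norm_ne_zero_iff.2 (hf0 v hv)) (norm_ne_zero_iff.2 hw0), Real.log_pow]
    push_cast; ring

end Wirtinger

namespace IsPowerSection

variable {m : ℕ} {H : Type*} [NormedAddCommGroup H] [InnerProductSpace ℂ H]
  {a : ℕ → ℝ} {T : Fin m → H →L[ℂ] H} {γ : Cn m → H}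

/-- Pairing with `γ 0` reads off the coefficient, since `⟪γ 0, γ w⟫ = a 0` for all `w`. The
coefficient is therefore holomorphic along any holomorphic family of eigenvectors. -/
theorem exists_smul_eq (hγ : IsPowerSection a T γ) (ha : 0 < a 0) {w : Cn m}
    (hw : w ∈ unitBall m) (hT : Module.finrank ℂ (jointKer T w) = 1) {x : H}
    (hx : x ∈ jointKer T w) : (inner ℂ (γ 0) x / a 0 : ℂ) • γ w = x := by
  obtain ⟨c, hc⟩ := exists_smul_eq_of_finrank_eq_one hT
    (x := (⟨γ w, hγ.mem_jointKer w hw⟩ : jointKer T w))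
    (fun h => hγ.ne_zero ha hw (congrArg Subtype.val h)) ⟨x, hx⟩
  have hc' : c • γ w = x := congrArg Subtype.val hc
  have h0 : (a 0 : ℂ) ≠ 0 := Complex.ofReal_ne_zero.2 ha.ne'
  rw [← hc', inner_smul_right, hγ.inner_origin_left hw, mul_div_cancel_right₀ _ h0]

variable [CompleteSpace H]

theorem contDiffAt_log_norm_sq (hγ : IsPowerSection a T γ) (hm : 1 ≤ m) (ha : ∀ l, 0 < a l)
    {w : Cn m} (hw : w ∈ unitBall m) : ContDiffAt ℝ 2 (fun v => Real.log (‖γ v‖ ^ 2)) w := by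
  have h := contDiffAt_of_differentiableOn isOpen_ball (hγ.differentiableOn hm ha) hw
  exact (h.norm_sq ℂ).log (pow_ne_zero 2 (norm_ne_zero_iff.2 (hγ.ne_zero (ha 0) hw)))

/-- The curvature is computed by any section with power series Gram function. -/
theorem curvature_eq (hγ : IsPowerSection a T γ) (hm : 1 ≤ m) (ha : ∀ l, 0 < a l)
    (hT : ∀ w ∈ unitBall m, Module.finrank ℂ (jointKer T w) = 1) {w : Cn m}
    (hw : w ∈ unitBall m) :
    curvature T w = -complexHessian (fun v => Real.log (‖γ v‖ ^ 2)) w := by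
  have hex : ∃ γ : Cn m → H, ∃ U : Set (Cn m), IsOpen U ∧ w ∈ U ∧ IsHolSection T U γ :=
    ⟨γ, unitBall m, isOpen_ball, hw, hγ.differentiableOn hm ha, hγ.mem_jointKer,
      fun v hv => hγ.ne_zero (ha 0) hv⟩
  rw [curvature, dif_pos hex, neg_inj]
  obtain ⟨U, hU, hwU, hsec⟩ := hex.choose_spec
  set η := hex.choose
  -- The transition function `η = f γ`; it changes `log ‖γ‖²` by the pluriharmonic function `log
  -- ‖f‖²`.
  set f : Cn m → ℂ := fun v => inner ℂ (γ 0) (η v) / a 0 with hf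
  have hV : IsOpen (U ∩ unitBall m) := hU.inter isOpen_ball
  have hwV : w ∈ U ∩ unitBall m := ⟨hwU, hw⟩
  have hfη : ∀ v ∈ U ∩ unitBall m, f v • γ v = η v := fun v hv =>
    hγ.exists_smul_eq (ha 0) hv.2 (hT v hv.2) (hsec.mem v hv.1)
  have hf0 : ∀ v ∈ U ∩ unitBall m, f v ≠ 0 := fun v hv h => hsec.ne_zero v hv.1 (by
    rw [← hfη v hv, h, zero_smul])
  have hfd : DifferentiableOn ℂ f (U ∩ unitBall m) := by
    simp only [hf, div_eq_mul_inv]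
    exact (((innerSL ℂ (γ 0)).differentiable.comp_differentiableOn hsec.holomorphic).mono
      inter_subset_left).mul_const _
  obtain ⟨F, V, hVo, hwV', hFd, hF⟩ := exists_log_norm_sq_eq hV hfd hf0 hwV
  have heq : (fun v => Real.log (‖η v‖ ^ 2)) =ᶠ[𝓝 w]
      (fun v => 2 * (F v).re) + fun v => Real.log (‖γ v‖ ^ 2) := by
    filter_upwards [hVo.mem_nhds hwV', hV.mem_nhds hwV] with v hv hv'
    rw [Pi.add_apply, ← hF v hv, ← hfη v hv', norm_smul, mul_pow, Real.log_mul]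
    · exact pow_ne_zero 2 (norm_ne_zero_iff.2 (hf0 v hv'))
    · exact pow_ne_zero 2 (norm_ne_zero_iff.2 (hγ.ne_zero (ha 0) hv'.2))
  have hFc : ContDiffAt ℝ 2 (fun v => 2 * (F v).re) w :=
    contDiffAt_const.mul
      (Complex.reCLM.contDiff.contDiffAt.comp w (contDiffAt_of_differentiableOn hVo hFd hwV'))
  rw [complexHessian_congr heq, complexHessian_add hFc (hγ.contDiffAt_log_norm_sq hm ha hw),
    complexHessian_two_mul_re hVo hFd hwV', zero_add]

end IsPowerSection

end CDTuple

/-! ### Sub-mean value property and mean values on discs. -/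

section Subharmonic

open Metric Set Filter Topology Real

/-- The sub-mean value property of `log ‖f‖` for analytic `f`. -/
theorem AnalyticOnNhd.log_norm_le_circleAverage {c : ℂ} {R : ℝ} {f : ℂ → ℂ} (hR : 0 < R)
    (hf : AnalyticOnNhd ℂ f (closedBall c R)) (hfc : f c ≠ 0) :
    Real.log ‖f c‖ ≤ circleAverage (fun z => Real.log ‖f z‖) c R := by
  rw [← abs_of_pos hR] at hf
  -- Jensen's formula: the average exceeds the central value by a sum over the zeros of nonnegative
  -- terms.
  rw [AnalyticOnNhd.circleAverage_log_norm hR.ne' hf hfc, le_add_iff_nonneg_left]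
  refine finsum_nonneg fun u => ?_
  by_cases hu : u ∈ closedBall c |R|
  · refine mul_nonneg (by exact_mod_cast MeromorphicOn.AnalyticOnNhd.divisor_nonneg hf u) ?_
    rw [mem_closedBall, dist_comm, dist_eq_norm, abs_of_pos hR] at hu
    rcases (norm_nonneg (c - u)).eq_or_lt with h0 | h0
    · simp [← h0]
    · refine Real.log_nonneg ?_
      rw [← div_eq_mul_inv, le_div_iff₀ h0]
      linarith
  · rw [Function.locallyFinsuppWithin.apply_eq_zero_of_notMem _ hu]; simp

/-- If `log ‖f‖ ≤ u` off the zeros of `f` on a circle, then `log ‖f‖` at the center is at most the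
average of `u`. -/
theorem AnalyticOnNhd.log_norm_le_circleAverage_of_le {c : ℂ} {R : ℝ} {f : ℂ → ℂ} (hR : 0 < R)
    (hf : AnalyticOnNhd ℂ f (closedBall c R)) (hfc : f c ≠ 0) {u : ℂ → ℝ}
    (hu : CircleIntegrable u c R) (h : ∀ z ∈ sphere c R, f z ≠ 0 → Real.log ‖f z‖ ≤ u z) :
    Real.log ‖f c‖ ≤ circleAverage u c R := by
  classical
  refine (hf.log_norm_le_circleAverage hR hfc).trans ?_
  have hsub : sphere c |R| ⊆ closedBall c R := by
    rw [abs_of_pos hR]; exact sphere_subset_closedBall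
  -- At a zero of `f` the convention `Real.log 0 = 0` may exceed `u`; changing the integrand on this
  -- discrete set leaves the average unchanged.
  set g : ℂ → ℝ := fun z => if f z = 0 then u z else Real.log ‖f z‖ with hg
  have hfg : (fun z => Real.log ‖f z‖) =ᶠ[codiscreteWithin (sphere c |R|)] g := by
    have h1 := AnalyticOnNhd.preimage_zero_mem_codiscreteWithin hf hfc
      (mem_closedBall_self hR.le) ((convex_closedBall c R).isConnected ⟨c, mem_closedBall_self hR.le⟩)
    filter_upwards [codiscreteWithin_mono hsub h1] with z hz
    simp only [hg]
    rw [if_neg (by simpa using hz)]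
  have hint : CircleIntegrable (fun z => Real.log ‖f z‖) c R :=
    MeromorphicOn.circleIntegrable_log_norm fun z hz => (hf z (hsub hz)).meromorphicAt
  rw [circleAverage_congr_codiscreteWithin hfg hR.ne']
  refine circleAverage_mono (hint.congr_codiscreteWithin hfg) hu fun z hz => ?_
  rw [abs_of_pos hR] at hz
  simp only [hg]
  split_ifs with h0
  exacts [le_rfl, h z hz h0]

end Subharmonic

namespace CDTuple

open Metric Set Filter Topology InnerProductSpace

section Harmonic

variable {m : ℕ}

theorem fderiv_ofReal_comp_apply {E : Type*} [NormedAddCommGroup E] [NormedSpace ℝ E] {u : E → ℝ}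
    {w : E} (hu : DifferentiableAt ℝ u w) (e : E) :
    fderiv ℝ (fun v => (u v : ℂ)) w e = (fderiv ℝ u w e : ℂ) := by
  have h := Complex.ofRealCLM.hasFDerivAt.comp w hu.hasFDerivAt
  have h2 : (fun v => (u v : ℂ)) = Complex.ofRealCLM ∘ u := rfl
  rw [h2, h.fderiv]; simp

/-- This is `∂∂̄ = Δ / 4` in one variable. Taking real parts removes the mixed second derivatives.
-/
theorem re_complexHessian_diag {u : Cn m → ℝ} {w : Cn m} (hu : ContDiffAt ℝ 2 u w) (i : Fin m) :
    (complexHessian u w i i).re =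
      (fderiv ℝ (fderiv ℝ u) w (EuclideanSpace.single i 1) (EuclideanSpace.single i 1) +
        fderiv ℝ (fderiv ℝ u) w (EuclideanSpace.single i Complex.I)
          (EuclideanSpace.single i Complex.I)) / 4 := by
  have hd : DifferentiableAt ℝ (fderiv ℝ u) w :=
    (hu.fderiv_right (m := 1) (by norm_num)).differentiableAt one_ne_zero
  have h1 : (fun v => dWbar i (fun x => (u x : ℂ)) v) =ᶠ[𝓝 w]
      fun v => (((fderiv ℝ u v (EuclideanSpace.single i 1) : ℝ) : ℂ) +
        Complex.I * ((fderiv ℝ u v (EuclideanSpace.single i Complex.I) : ℝ) : ℂ)) / 2 := by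
    filter_upwards [hu.eventually (by simp)] with v hv
    have := hv.differentiableAt two_ne_zero
    simp only [dWbar, fderiv_ofReal_comp_apply this]
  have h2 : ∀ e : Cn m, HasFDerivAt (fun v => ((fderiv ℝ u v e : ℝ) : ℂ))
      (Complex.ofRealCLM ∘L (ContinuousLinearMap.apply ℝ ℝ e ∘L fderiv ℝ (fderiv ℝ u) w)) w :=
    fun e => Complex.ofRealCLM.hasFDerivAt.comp w
      ((ContinuousLinearMap.apply ℝ ℝ e).hasFDerivAt.comp w hd.hasFDerivAt)
  have h3 : HasFDerivAt (fun v => (((fderiv ℝ u v (EuclideanSpace.single i 1) : ℝ) : ℂ) +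
      Complex.I * ((fderiv ℝ u v (EuclideanSpace.single i Complex.I) : ℝ) : ℂ)) * (2⁻¹ : ℂ)) _ w :=
    ((h2 (EuclideanSpace.single i 1)).add
      ((h2 (EuclideanSpace.single i Complex.I)).const_mul Complex.I)).mul_const (2⁻¹ : ℂ)
  have h4 : complexHessian u w i i = dW i (fun v => dWbar i (fun x => (u x : ℂ)) v) w := rfl
  rw [h4, dW_congr h1]
  simp only [div_eq_mul_inv]
  rw [dW, h3.fderiv]
  have h5 : ((2 : ℂ)⁻¹).re = 1 / 2 := by simp [Complex.normSq]
  have h6 : ((2 : ℂ)⁻¹).im = 0 := by simp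
  simp [-Complex.inv_re, -Complex.inv_im, h5, h6]
  ring

/-- A `C²` function with vanishing complex Hessian has the mean value property on discs in
the coordinate directions. -/
theorem circleAverage_eq_of_complexHessian_eq_zero {u : Cn m → ℝ}
    (hu : ContDiffOn ℝ 2 u (unitBall m)) (h0 : ∀ w ∈ unitBall m, complexHessian u w = 0)
    (i : Fin m) {r : ℝ} (hr0 : 0 ≤ r) (hr1 : r < 1) :
    Real.circleAverage (fun z : ℂ => u (EuclideanSpace.single i z)) 0 r = u 0 := by
  set L : ℂ →L[ℝ] Cn m := LinearMap.toContinuousLinearMap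
    { toFun := fun z => EuclideanSpace.single i z
      map_add' := fun x y => by ext j; by_cases h : j = i <;> simp [h]
      map_smul' := fun c x => by ext j; by_cases h : j = i <;> simp [h] } with hL
  have hLa : ∀ z, L z = EuclideanSpace.single i z := fun z => rfl
  have hLm : ∀ z : ℂ, ‖z‖ < 1 → L z ∈ unitBall m := fun z hz => by
    rw [mem_ball_zero_iff, hLa]; simpa using hz
  have huc : ∀ z : ℂ, ‖z‖ < 1 → ContDiffAt ℝ 2 u (L z) := fun z hz =>
    hu.contDiffAt (isOpen_ball.mem_nhds (hLm z hz))
  have hlap : ∀ z : ℂ, ‖z‖ < 1 → Laplacian.laplacian (u ∘ L) z = 0 := by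
    intro z hz
    have hd : DifferentiableAt ℝ (fderiv ℝ u) (L z) :=
      ((huc z hz).fderiv_right (m := 1) (by norm_num)).differentiableAt one_ne_zero
    have h1 : fderiv ℝ (u ∘ L) =ᶠ[𝓝 z] fun x => (fderiv ℝ u (L x)) ∘L L := by
      filter_upwards [isOpen_ball.mem_nhds (mem_ball_zero_iff.2 hz)] with x hx
      rw [fderiv_comp x ((huc x (mem_ball_zero_iff.1 hx)).differentiableAt two_ne_zero)
        L.differentiableAt, L.fderiv]
    have h2 : ∀ e, fderiv ℝ (fderiv ℝ (u ∘ L)) z e e =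
        fderiv ℝ (fderiv ℝ u) (L z) (L e) (L e) := fun e => by
      rw [h1.fderiv_eq]
      have h3 : HasFDerivAt (fun x => (fderiv ℝ u (L x)) ∘L L) _ z :=
        (hd.hasFDerivAt.comp z L.hasFDerivAt).clm_comp (hasFDerivAt_const L z)
      rw [h3.fderiv]
      simp
    rw [laplacian_eq_iteratedFDeriv_complexPlane]
    simp only [iteratedFDeriv_two_apply, Matrix.cons_val_zero, Matrix.cons_val_one, h2, hLa]
    have h5 := re_complexHessian_diag (huc z hz) i
    rw [h0 _ (hLm z hz)] at h5
    simp only [hLa] at h5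
    simp at h5
    linarith
  have hharm : HarmonicOnNhd (u ∘ L) (closedBall 0 |r|) := fun z hz => by
    rw [mem_closedBall_zero_iff, abs_of_nonneg hr0] at hz
    have hz1 := hz.trans_lt hr1
    refine ⟨(huc z hz1).comp z L.contDiff.contDiffAt, ?_⟩
    filter_upwards [isOpen_ball.mem_nhds (mem_ball_zero_iff.2 hz1)] with x hx
    exact hlap x (mem_ball_zero_iff.1 hx)
  have h := hharm.circleAverage_eq
  rwa [Function.comp_apply, map_zero] at h

end Harmonic

end CDTuple

/-! ### The quotient of the squared norms: plurisubharmonicity and boundedness. -/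

namespace CDTuple

open Metric Set Filter Topology InnerProductSpace

namespace IsPowerSection

variable {m : ℕ} {H : Type*} [NormedAddCommGroup H] [InnerProductSpace ℂ H]
  {a : ℕ → ℝ} {T : Fin m → H →L[ℂ] H} {γ : Cn m → H}
  {H' : Type*} [NormedAddCommGroup H'] [InnerProductSpace ℂ H']
  {b : ℕ → ℝ} {S : Fin m → H' →L[ℂ] H'} {γ' : Cn m → H'} {n : ℕ}

theorem one_sub_pow_mul_norm_sq
    (hker : ∀ u ∈ unitBall m, ∀ v ∈ unitBall m,
      (1 - inner ℂ u v) ^ n * inner ℂ (γ' u) (γ' v) = 1) {v : Cn m} (hv : v ∈ unitBall m) :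
    (1 - ‖v‖ ^ 2) ^ n * ‖γ' v‖ ^ 2 = 1 := by
  have h := hker v hv v hv
  rw [inner_self_eq_ofReal_norm_sq, inner_self_eq_ofReal_norm_sq] at h
  exact_mod_cast h

/-- The power series of the quotient `‖γ‖² / ‖γ'‖²`. -/
theorem hasSum_norm_sq_div (hγ : IsPowerSection a T γ)
    (hker : ∀ u ∈ unitBall m, ∀ v ∈ unitBall m,
      (1 - inner ℂ u v) ^ n * inner ℂ (γ' u) (γ' v) = 1) {v : Cn m} (hv : v ∈ unitBall m) :
    HasSum (fun l => backDiff^[n] a l * (‖v‖ ^ 2) ^ l) (‖γ v‖ ^ 2 / ‖γ' v‖ ^ 2) := by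
  have h := hasSum_backDiff_iterate (hγ.hasSum_inner v hv v hv) n
  have h1 := one_sub_pow_mul_norm_sq hker hv
  have h2 : ‖γ v‖ ^ 2 / ‖γ' v‖ ^ 2 = (1 - ‖v‖ ^ 2) ^ n * ‖γ v‖ ^ 2 := by
    rw [div_eq_iff (right_ne_zero_of_mul_eq_one h1), mul_right_comm, h1, one_mul]
  rw [h2]
  simp only [inner_self_eq_ofReal_norm_sq] at h
  exact Complex.hasSum_ofReal.1 (by push_cast at h ⊢; exact h)

/-- The quotient is a power series in `‖v‖²`. Its radiality turns estimates on circles into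
pointwise bounds. -/
theorem norm_sq_div_eq_of_norm_eq (hγ : IsPowerSection a T γ)
    (hker : ∀ u ∈ unitBall m, ∀ v ∈ unitBall m,
      (1 - inner ℂ u v) ^ n * inner ℂ (γ' u) (γ' v) = 1) {u v : Cn m} (hu : u ∈ unitBall m)
    (hv : v ∈ unitBall m) (huv : ‖u‖ = ‖v‖) :
    ‖γ u‖ ^ 2 / ‖γ' u‖ ^ 2 = ‖γ v‖ ^ 2 / ‖γ' v‖ ^ 2 := by
  have h := hγ.hasSum_norm_sq_div hker hu
  rw [huv] at h
  exact h.unique (hγ.hasSum_norm_sq_div hker hv)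

theorem le_norm_sq_div (hγ : IsPowerSection a T γ)
    (hker : ∀ u ∈ unitBall m, ∀ v ∈ unitBall m,
      (1 - inner ℂ u v) ^ n * inner ℂ (γ' u) (γ' v) = 1) (hc : ∀ i, 0 ≤ backDiff^[n] a i)
    {v : Cn m} (hv : v ∈ unitBall m) : a 0 ≤ ‖γ v‖ ^ 2 / ‖γ' v‖ ^ 2 := by
  have h := le_hasSum (hγ.hasSum_norm_sq_div hker hv) 0 fun l _ => mul_nonneg (hc l) (by positivity)
  simpa [backDiff_iterate_zero] using h

/-- Cauchy–Schwarz for the kernel with coefficients `c ≥ 0`, proved termwise by a weighted AM-GM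
inequality; the weights `√B / √A` and `√A / √B` make the total exactly `√A * √B`. -/
theorem norm_kernel_quotient_sq_le (hγ : IsPowerSection a T γ)
    (hker : ∀ u ∈ unitBall m, ∀ v ∈ unitBall m,
      (1 - inner ℂ u v) ^ n * inner ℂ (γ' u) (γ' v) = 1) (ha : 0 < a 0)
    (hc : ∀ i, 0 ≤ backDiff^[n] a i) {u v : Cn m} (hu : u ∈ unitBall m) (hv : v ∈ unitBall m) :
    ‖(1 - inner ℂ u v) ^ n * inner ℂ (γ u) (γ v)‖ ^ 2 ≤
      (‖γ u‖ ^ 2 / ‖γ' u‖ ^ 2) * (‖γ v‖ ^ 2 / ‖γ' v‖ ^ 2) := by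
  have hsu := hγ.hasSum_norm_sq_div hker hu
  have hsv := hγ.hasSum_norm_sq_div hker hv
  have hs := hasSum_backDiff_iterate (hγ.hasSum_inner u hu v hv) n
  have hup := ha.trans_le (hγ.le_norm_sq_div hker hc hu)
  have hvp := ha.trans_le (hγ.le_norm_sq_div hker hc hv)
  set A := ‖γ u‖ ^ 2 / ‖γ' u‖ ^ 2
  set B := ‖γ v‖ ^ 2 / ‖γ' v‖ ^ 2
  set G := (1 - inner ℂ u v) ^ n * inner ℂ (γ u) (γ v)
  have hAB : 0 < √A ∧ 0 < √B := ⟨Real.sqrt_pos.2 hup, Real.sqrt_pos.2 hvp⟩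
  obtain ⟨hA, hB⟩ := hAB
  have h : ‖G‖ ≤ (√B / √A * A + √A / √B * B) / 2 := by
    rw [← hs.tsum_eq]
    refine tsum_of_norm_bounded (((hsu.mul_left (√B / √A)).add
      (hsv.mul_left (√A / √B))).div_const 2) fun l => ?_
    have h1 : ‖(inner ℂ u v : ℂ)‖ ^ l ≤ ‖u‖ ^ l * ‖v‖ ^ l := by
      rw [← mul_pow]; gcongr; exact norm_inner_le_norm u v
    have h2 : 2 * (‖u‖ ^ l * ‖v‖ ^ l) ≤
        √B / √A * (‖u‖ ^ 2) ^ l + √A / √B * (‖v‖ ^ 2) ^ l := by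
      have h3 : √B / √A * (‖u‖ ^ 2) ^ l + √A / √B * (‖v‖ ^ 2) ^ l - 2 * (‖u‖ ^ l * ‖v‖ ^ l) =
          (√B * ‖u‖ ^ l - √A * ‖v‖ ^ l) ^ 2 / (√A * √B) := by
        rw [← pow_mul, ← pow_mul, mul_comm 2 l, pow_mul, pow_mul]
        field_simp
        ring
      have h4 : 0 ≤ (√B * ‖u‖ ^ l - √A * ‖v‖ ^ l) ^ 2 / (√A * √B) := by positivity
      linarith
    rw [norm_mul, norm_pow, Complex.norm_real, Real.norm_of_nonneg (hc l)]
    nlinarith [mul_le_mul_of_nonneg_left h1 (hc l), mul_le_mul_of_nonneg_left h2 (hc l)]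
  have h5 : (√B / √A * A + √A / √B * B) / 2 = √A * √B := by
    have h6 : ∀ p q : ℝ, 0 < p → 0 < q → (q / p * (p * p) + p / q * (q * q)) / 2 = p * q :=
      fun p q hp hq => by field_simp; ring
    have h7 := h6 _ _ hA hB
    rwa [Real.mul_self_sqrt hup.le, Real.mul_self_sqrt hvp.le] at h7
  rw [h5] at h
  calc ‖G‖ ^ 2 ≤ (√A * √B) ^ 2 := by gcongr
    _ = A * B := by rw [mul_pow, Real.sq_sqrt hup.le, Real.sq_sqrt hvp.le]

/-- The logarithm of `‖γ‖² / ‖γ'‖²` is plurisubharmonic if its power series has nonnegative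
coefficients. -/
theorem isPlurisubharmonicOn_log_div [CompleteSpace H] [CompleteSpace H']
    (hγ : IsPowerSection a T γ) (hγ' : IsPowerSection b S γ')
    (hker : ∀ u ∈ unitBall m, ∀ v ∈ unitBall m,
      (1 - inner ℂ u v) ^ n * inner ℂ (γ' u) (γ' v) = 1) (hm : 1 ≤ m) (ha : ∀ l, 0 < a l)
    (hb : ∀ l, 0 < b l) (hc : ∀ i, 0 ≤ backDiff^[n] a i) :
    IsPlurisubharmonicOn (fun v => Real.log (‖γ v‖ ^ 2 / ‖γ' v‖ ^ 2)) (unitBall m) := by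
  have hpos : ∀ v ∈ unitBall m, 0 < ‖γ v‖ ^ 2 / ‖γ' v‖ ^ 2 := fun v hv =>
    (ha 0).trans_le (hγ.le_norm_sq_div hker hc hv)
  have hcont : ContinuousOn (fun v => Real.log (‖γ v‖ ^ 2 / ‖γ' v‖ ^ 2)) (unitBall m) := by
    refine ContinuousOn.log (ContinuousOn.div ?_ ?_ ?_) fun v hv => (hpos v hv).ne'
    · exact (hγ.differentiableOn hm ha).continuousOn.norm.pow 2
    · exact (hγ'.differentiableOn hm hb).continuousOn.norm.pow 2
    · exact fun v hv => pow_ne_zero 2 (norm_ne_zero_iff.2 (hγ'.ne_zero (hb 0) hv))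
  refine ⟨hcont.upperSemicontinuousOn, fun x y hxy => ?_⟩
  have hline : Continuous fun l : ℂ => x + l • y := by fun_prop
  have hint : CircleIntegrable
      (fun l : ℂ => Real.log (‖γ (x + l • y)‖ ^ 2 / ‖γ' (x + l • y)‖ ^ 2)) 0 1 := by
    refine ContinuousOn.circleIntegrable zero_le_one (hcont.comp hline.continuousOn fun l hl => ?_)
    exact hxy l (mem_sphere_zero_iff_norm.1 hl).le
  refine ⟨hint, ?_⟩
  have hx : x ∈ unitBall m := by simpa using hxy 0 (by simp)
  -- The polarized quotient `G` is holomorphic along the disc. With `q` the quotient of squared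
  -- norms, `G 0 = q x` and `‖G l‖² ≤ q(x) q(x + l y)`. Averaging `log ‖G‖` gives `log q(x) ≤ (log
  -- q(x) + average of log q) / 2`, and half of `log q(x)` cancels.
  set G : ℂ → ℂ := fun l => (1 - inner ℂ x (x + l • y)) ^ n * inner ℂ (γ x) (γ (x + l • y)) with hG
  set V : Set ℂ := (fun l : ℂ => x + l • y) ⁻¹' unitBall m with hV
  have hVo : IsOpen V := isOpen_ball.preimage hline
  have hGd : DifferentiableOn ℂ G V := by
    have h1 : DifferentiableOn ℂ (fun l : ℂ => γ (x + l • y)) V :=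
      (hγ.differentiableOn hm ha).comp (by fun_prop) fun l hl => hl
    have h2 : Differentiable ℂ fun l : ℂ => inner ℂ x (x + l • y) :=
      (innerSL ℂ x).differentiable.comp (by fun_prop)
    exact ((h2.const_sub 1).pow n).differentiableOn.mul
      ((innerSL ℂ (γ x)).differentiable.comp_differentiableOn h1)
  have hGa : AnalyticOnNhd ℂ G (closedBall 0 1) := (hGd.analyticOnNhd hVo).mono fun l hl =>
    hxy l (mem_closedBall_zero_iff.1 hl)
  have hG0 : G 0 = ((‖γ x‖ ^ 2 / ‖γ' x‖ ^ 2 : ℝ) : ℂ) := by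
    have h1 := one_sub_pow_mul_norm_sq hker hx
    simp only [hG, zero_smul, add_zero, inner_self_eq_ofReal_norm_sq]
    norm_cast
    rw [eq_div_iff (right_ne_zero_of_mul_eq_one h1), mul_right_comm, h1, one_mul]
  have hG0' : Real.log ‖G 0‖ = Real.log (‖γ x‖ ^ 2 / ‖γ' x‖ ^ 2) := by
    rw [hG0, Complex.norm_real, Real.norm_of_nonneg (hpos x hx).le]
  have key := hGa.log_norm_le_circleAverage_of_le one_pos
    (hG0 ▸ Complex.ofReal_ne_zero.2 (hpos x hx).ne')
    (u := fun l => (1 / 2 : ℝ) • (Real.log (‖γ x‖ ^ 2 / ‖γ' x‖ ^ 2) +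
      Real.log (‖γ (x + l • y)‖ ^ 2 / ‖γ' (x + l • y)‖ ^ 2)))
    (((circleIntegrable_const _ _ _).add hint).const_fun_smul) fun l hl hl0 => by
      have hlb := hxy l (mem_sphere_zero_iff_norm.1 hl).le
      have h1 := hγ.norm_kernel_quotient_sq_le hker (ha 0) hc hx hlb
      have h2 := Real.log_le_log (pow_pos (norm_pos_iff.2 hl0) 2) h1
      rw [Real.log_pow, Real.log_mul (hpos x hx).ne' (hpos _ hlb).ne'] at h2
      push_cast at h2
      rw [smul_eq_mul]
      linarith
  rw [Real.circleAverage_fun_smul, Real.circleAverage_fun_add (circleIntegrable_const _ _ _) hint,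
    Real.circleAverage_const, hG0', smul_eq_mul] at key
  linarith

/-- Similarity to the second tuple bounds the quotient `‖γ‖² / ‖γ'‖²`. -/
theorem exists_norm_sq_div_le_of_similar [CompleteSpace H']
    (hγ : IsPowerSection a T γ) (hγ' : IsPowerSection b S γ')
    (hker : ∀ u ∈ unitBall m, ∀ v ∈ unitBall m,
      (1 - inner ℂ u v) ^ n * inner ℂ (γ' u) (γ' v) = 1) (hm : 1 ≤ m) (ha : ∀ l, 0 < a l)
    (hb : ∀ l, 0 < b l)
    (hT : ∀ w ∈ unitBall m, Module.finrank ℂ (jointKer T w) = 1) (hsim : Similar T S) :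
    ∃ C : ℝ, ∀ v ∈ unitBall m, ‖γ v‖ ^ 2 / ‖γ' v‖ ^ 2 ≤ C := by
  obtain ⟨X, hX⟩ := hsim
  set Y : H' →L[ℂ] H := (X.symm : H' →L[ℂ] H) with hY
  set χ : Cn m → ℂ := fun v => inner ℂ (γ 0) (Y (γ' v)) / a 0 with hχ
  have hχγ : ∀ v ∈ unitBall m, χ v • γ v = Y (γ' v) := fun v hv => by
    refine hγ.exists_smul_eq (ha 0) hv (hT v hv) (mem_jointKer_iff.2 fun i => ?_)
    have h := mem_jointKer_iff.1 (hγ'.mem_jointKer v hv) i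
    apply X.injective
    rw [hX, map_smul, hY]
    simpa using h
  have hχ0 : χ 0 ≠ 0 := fun h => by
    have h1 := hχγ 0 (zero_mem_unitBall m)
    rw [h, zero_smul] at h1
    exact hγ'.ne_zero (hb 0) (zero_mem_unitBall m) (X.symm.injective (by simpa [hY] using h1.symm))
  have hγ0 : ∀ v ∈ unitBall m, 0 < ‖γ v‖ ^ 2 := fun v hv =>
    pow_pos (norm_pos_iff.2 (hγ.ne_zero (ha 0) hv)) 2
  have hγ'0 : ∀ v ∈ unitBall m, 0 < ‖γ' v‖ ^ 2 := fun v hv =>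
    pow_pos (norm_pos_iff.2 (hγ'.ne_zero (hb 0) hv)) 2
  have hχle : ∀ v ∈ unitBall m, ‖χ v‖ ^ 2 * (‖γ v‖ ^ 2 / ‖γ' v‖ ^ 2) ≤ ‖Y‖ ^ 2 := fun v hv => by
    rw [← mul_div_assoc, div_le_iff₀ (hγ'0 v hv), ← mul_pow, ← mul_pow, ← norm_smul, hχγ v hv]
    gcongr
    exact Y.le_opNorm _
  refine ⟨‖Y‖ ^ 2 / ‖χ 0‖ ^ 2, fun v hv => ?_⟩
  have hLpos : 0 < ‖γ v‖ ^ 2 / ‖γ' v‖ ^ 2 := div_pos (hγ0 v hv) (hγ'0 v hv)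
  have hχd : DifferentiableOn ℂ χ (unitBall m) := by
    simp only [hχ, div_eq_mul_inv]
    exact ((((innerSL ℂ (γ 0)).differentiable.comp Y.differentiable).comp_differentiableOn
      (hγ'.differentiableOn hm hb))).mul_const _
  have hvz : ∀ z : ℂ, ‖z‖ ≤ 1 → z • v ∈ unitBall m := fun z hz => by
    rw [mem_ball_zero_iff] at hv ⊢
    rw [norm_smul]
    nlinarith [norm_nonneg v]
  -- Maximum principle for `χ` on the disc through `v`: on its boundary circle the quotient has the
  -- same value as at `v`, so `hχle` bounds `χ 0` in terms of that value.
  have hsl : DiffContOnCl ℂ (fun z : ℂ => χ (z • v)) (ball 0 1) := by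
    refine DifferentiableOn.diffContOnCl (hχd.comp (by fun_prop) fun z hz => hvz z ?_)
    rw [closure_ball _ one_ne_zero] at hz
    exact mem_closedBall_zero_iff.1 hz
  have h1 := Complex.norm_le_of_forall_mem_frontier_norm_le isBounded_ball hsl
    (C := √(‖Y‖ ^ 2 / (‖γ v‖ ^ 2 / ‖γ' v‖ ^ 2))) (fun z hz => ?_)
    (subset_closure (mem_ball_self one_pos))
  · rw [zero_smul] at h1
    have h2 := (Real.le_sqrt (norm_nonneg _) (by positivity)).1 h1
    rw [le_div_iff₀ hLpos] at h2
    rw [le_div_iff₀ (pow_pos (norm_pos_iff.2 hχ0) 2)]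
    linarith
  · rw [frontier_ball _ one_ne_zero, mem_sphere_zero_iff_norm] at hz
    have hzv := hvz z hz.le
    refine Real.le_sqrt_of_sq_le ?_
    rw [le_div_iff₀ hLpos, hγ.norm_sq_div_eq_of_norm_eq hker hv hzv (by rw [norm_smul, hz, one_mul])]
    exact hχle _ hzv

end IsPowerSection

end CDTuple

/-! ### From a bounded potential to bounded partial sums. -/

theorem mul_choose_succ_le_choose (k : ℕ) {δ : ℝ} (hδ : δ < 1) :
    ∃ N : ℕ, ∀ l, N ≤ l → δ * ((l + 1 + k).choose k : ℝ) ≤ ((l + k).choose k : ℝ) := by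
  obtain ⟨N, hN⟩ := exists_nat_ge (δ * k / (1 - δ))
  refine ⟨N, fun l hl => ?_⟩
  have h1 : ((l + k).choose k : ℝ) * (l + k + 1) = ((l + 1 + k).choose k : ℝ) * (l + 1) := by
    have h := Nat.choose_mul_succ_eq (l + k) k
    rw [show l + k + 1 - k = l + 1 by omega, show l + k + 1 = l + 1 + k by omega] at h
    rw [show (l : ℝ) + k + 1 = l + 1 + k by ring]
    exact_mod_cast h
  have h2 : δ * k ≤ (1 - δ) * l := by
    rw [← div_le_iff₀' (sub_pos.2 hδ)]
    exact hN.trans (by exact_mod_cast hl)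
  have h3 : δ * (l + k + 1) ≤ l + 1 := by linarith
  have h4 : (0 : ℝ) < l + 1 := by positivity
  refine le_of_mul_le_mul_right ?_ h4
  calc δ * ((l + 1 + k).choose k : ℝ) * (l + 1) = (δ * (l + k + 1)) * ((l + k).choose k : ℝ) := by
        rw [mul_assoc, ← h1]; ring
    _ ≤ (l + 1) * ((l + k).choose k : ℝ) := by gcongr
    _ = _ := mul_comm _ _

/-- Finite sums are continuous in `t` and, as `c ≥ 0`, bounded by the full series; let `t` increase
to `1`. -/
theorem partialSum_le_of_hasSum_le {c : ℕ → ℝ} (hc : ∀ l, 0 ≤ c l) {B : ℝ}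
    (h : ∀ t : ℝ, 0 < t → t < 1 → ∃ s ≤ B, HasSum (fun l => c l * t ^ l) s) (i : ℕ) :
    partialSum c i ≤ B := by
  have hcont : Continuous fun t : ℝ => ∑ l ∈ Finset.range (i + 1), c l * t ^ l := by fun_prop
  have hlim : Filter.Tendsto (fun t : ℝ => ∑ l ∈ Finset.range (i + 1), c l * t ^ l)
      (nhdsWithin 1 (Set.Iio 1)) (nhds (partialSum c i)) := by
    have h1 := (hcont.tendsto 1).mono_left (nhdsWithin_le_nhds (s := Set.Iio 1))
    simpa [partialSum] using h1
  refine le_of_tendsto hlim ?_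
  filter_upwards [Ioo_mem_nhdsLT (zero_lt_one (α := ℝ))] with t ht
  obtain ⟨s, hs, hsum⟩ := h t ht.1 ht.2
  exact (sum_le_hasSum _ (fun l _ => mul_nonneg (hc l) (pow_nonneg ht.1.le l)) hsum).trans hs

namespace CDTuple

open Metric Set Filter Topology InnerProductSpace

namespace IsPowerSection

variable {m : ℕ} {H : Type*} [NormedAddCommGroup H] [InnerProductSpace ℂ H] [CompleteSpace H]
  {a : ℕ → ℝ} {T : Fin m → H →L[ℂ] H} {γ : Cn m → H}
  {H' : Type*} [NormedAddCommGroup H'] [InnerProductSpace ℂ H'] [CompleteSpace H']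
  {b : ℕ → ℝ} {S : Fin m → H' →L[ℂ] H'} {γ' : Cn m → H'} {n : ℕ}

theorem contDiffAt_log_div (hγ : IsPowerSection a T γ) (hγ' : IsPowerSection b S γ')
    (hm : 1 ≤ m) (ha : ∀ l, 0 < a l) (hb : ∀ l, 0 < b l) {w : Cn m} (hw : w ∈ unitBall m) :
    ContDiffAt ℝ 2 (fun v => Real.log (‖γ v‖ ^ 2 / ‖γ' v‖ ^ 2)) w := by
  have h := contDiffAt_of_differentiableOn isOpen_ball (hγ.differentiableOn hm ha) hw
  have h' := contDiffAt_of_differentiableOn isOpen_ball (hγ'.differentiableOn hm hb) hw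
  have h0 := pow_ne_zero 2 (norm_ne_zero_iff.2 (hγ.ne_zero (ha 0) hw))
  have h0' := pow_ne_zero 2 (norm_ne_zero_iff.2 (hγ'.ne_zero (hb 0) hw))
  exact ((h.norm_sq ℂ).div (h'.norm_sq ℂ) h0').log (div_ne_zero h0 h0')

theorem curvature_sub_curvature (hγ : IsPowerSection a T γ) (hγ' : IsPowerSection b S γ')
    (hm : 1 ≤ m) (ha : ∀ l, 0 < a l) (hb : ∀ l, 0 < b l)
    (hT : ∀ w ∈ unitBall m, Module.finrank ℂ (jointKer T w) = 1)
    (hS : ∀ w ∈ unitBall m, Module.finrank ℂ (jointKer S w) = 1) {w : Cn m}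
    (hw : w ∈ unitBall m) :
    curvature S w - curvature T w =
      complexHessian (fun v => Real.log (‖γ v‖ ^ 2 / ‖γ' v‖ ^ 2)) w := by
  rw [hγ.curvature_eq hm ha hT hw, hγ'.curvature_eq hm hb hS hw, neg_sub_neg,
    ← complexHessian_sub (hγ.contDiffAt_log_norm_sq hm ha hw)
      (hγ'.contDiffAt_log_norm_sq hm hb hw)]
  refine complexHessian_congr ?_
  filter_upwards [isOpen_ball.mem_nhds hw] with v hv
  rw [Pi.sub_apply, Real.log_div (pow_ne_zero 2 (norm_ne_zero_iff.2 (hγ.ne_zero (ha 0) hv)))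
    (pow_ne_zero 2 (norm_ne_zero_iff.2 (hγ'.ne_zero (hb 0) hv)))]

/-- A bounded potential of the difference of the curvatures bounds the coefficients of the power
series of `‖γ‖² / ‖γ'‖²`. -/
theorem exists_partialSum_le (hγ : IsPowerSection a T γ) (hγ' : IsPowerSection b S γ')
    (hker : ∀ u ∈ unitBall m, ∀ v ∈ unitBall m,
      (1 - inner ℂ u v) ^ n * inner ℂ (γ' u) (γ' v) = 1) (hm : 1 ≤ m) (ha : ∀ l, 0 < a l)
    (hb : ∀ l, 0 < b l) (hc : ∀ i, 0 ≤ backDiff^[n] a i) {ψ : Cn m → ℝ} {C : ℝ}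
    (hψC : ∀ w ∈ unitBall m, |ψ w| ≤ C) (hψ : ContDiffOn ℝ 2 ψ (unitBall m))
    (hHess : ∀ w ∈ unitBall m, complexHessian ψ w =
      complexHessian (fun v => Real.log (‖γ v‖ ^ 2 / ‖γ' v‖ ^ 2)) w) :
    ∃ B : ℝ, ∀ i, partialSum (backDiff^[n] a) i ≤ B := by
  set φ : Cn m → ℝ := fun v => Real.log (‖γ v‖ ^ 2 / ‖γ' v‖ ^ 2) with hφ
  have hφc : ∀ w ∈ unitBall m, ContDiffAt ℝ 2 φ w := fun w hw =>
    hγ.contDiffAt_log_div hγ' hm ha hb hw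
  have hψc : ∀ w ∈ unitBall m, ContDiffAt ℝ 2 ψ w := fun w hw =>
    hψ.contDiffAt (isOpen_ball.mem_nhds hw)
  refine ⟨Real.exp (C - (ψ - φ) 0), partialSum_le_of_hasSum_le hc fun t ht0 ht1 => ?_⟩
  set i₀ : Fin m := ⟨0, hm⟩
  have hr0 : 0 < √t := Real.sqrt_pos.2 ht0
  have hr1 : √t < 1 := by rw [Real.sqrt_lt' one_pos]; simpa
  have hmem : ∀ z ∈ sphere (0 : ℂ) √t, EuclideanSpace.single i₀ z ∈ unitBall m := fun z hz => by
    rw [mem_ball_zero_iff, PiLp.norm_single, mem_sphere_zero_iff_norm.1 hz]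
    exact hr1
  have hz₀ : ((√t : ℝ) : ℂ) ∈ sphere (0 : ℂ) √t := by
    rw [mem_sphere_zero_iff_norm, Complex.norm_real, Real.norm_of_nonneg hr0.le]
  set v₀ : Cn m := EuclideanSpace.single i₀ ((√t : ℝ) : ℂ) with hv₀
  have hv₀m : v₀ ∈ unitBall m := hmem _ hz₀
  have hnorm : ∀ z ∈ sphere (0 : ℂ) √t,
      ‖(EuclideanSpace.single i₀ z : Cn m)‖ = √t := fun z hz => by
    rw [PiLp.norm_single, mem_sphere_zero_iff_norm.1 hz]
  -- The mean of `ψ - φ` over the circle is its value at `0`. On the circle `φ` is constant and `ψ ≤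
  -- C`, hence `φ v₀ ≤ C - (ψ - φ) 0`. The radius `√t` makes `‖v₀‖² = t`.
  have hmean := circleAverage_eq_of_complexHessian_eq_zero (u := ψ - φ)
    (fun w hw => ((hψc w hw).sub (hφc w hw)).contDiffWithinAt)
    (fun w hw => by rw [complexHessian_sub (hψc w hw) (hφc w hw), hHess w hw, sub_self])
    i₀ hr0.le hr1
  have hle : (ψ - φ) 0 ≤ C - φ v₀ := by
    rw [← hmean]
    refine Real.circleAverage_mono_on_of_le_circle ?_ fun z hz => ?_
    · refine ContinuousOn.circleIntegrable hr0.le fun z hz => ContinuousAt.continuousWithinAt ?_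
      have h1 : ContinuousAt (ψ - φ) (EuclideanSpace.single i₀ z) :=
        ((hψc _ (hmem z hz)).sub (hφc _ (hmem z hz))).continuousAt
      have h2 : Continuous fun z : ℂ => (EuclideanSpace.single i₀ z : Cn m) :=
        (PiLp.continuous_toLp 2 _).comp (continuous_single (A := fun _ : Fin m => ℂ) i₀)
      exact ContinuousAt.comp (f := fun z : ℂ => (EuclideanSpace.single i₀ z : Cn m)) h1
        h2.continuousAt
    · rw [abs_of_pos hr0] at hz
      have h1 : φ (EuclideanSpace.single i₀ z) = φ v₀ :=
        congrArg Real.log (hγ.norm_sq_div_eq_of_norm_eq hker (hmem z hz) hv₀m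
          ((hnorm z hz).trans (hnorm _ hz₀).symm))
      rw [Pi.sub_apply, h1]
      linarith [le_of_abs_le (hψC _ (hmem z hz))]
  have hsum := hγ.hasSum_norm_sq_div hker hv₀m
  rw [hnorm _ hz₀, Real.sq_sqrt ht0.le] at hsum
  refine ⟨_, ?_, hsum⟩
  have hpos := (ha 0).trans_le (hγ.le_norm_sq_div hker hc hv₀m)
  rw [← Real.log_le_iff_le_exp hpos]
  change φ v₀ ≤ _
  linarith

end IsPowerSection

/-! ### Kernel functions as a power section. -/

section ReproducingKernel

variable {m : ℕ} {H : Type*} [NormedAddCommGroup H] [InnerProductSpace ℂ H] [CompleteSpace H]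
  [RKHS ℂ H (unitBall m) ℂ]

/-- The coordinatewise complex conjugate. -/
def conjVec (v : Cn m) : Cn m := WithLp.toLp 2 fun i => conj (v i)

theorem inner_conjVec (u v : Cn m) : inner ℂ (conjVec v) (conjVec u) = inner ℂ u v := by
  simp [conjVec, PiLp.inner_apply, mul_comm]

theorem conjVec_mem {v : Cn m} (hv : v ∈ unitBall m) : conjVec v ∈ unitBall m := by
  have h : ‖conjVec v‖ = ‖v‖ := by simp [conjVec, EuclideanSpace.norm_eq]
  rw [mem_ball_zero_iff] at hv ⊢
  rwa [h]

open Classical in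
variable (H) in
/-- The kernel function of `H` at the conjugate point, extended by zero. -/
noncomputable def conjKernelSection (v : Cn m) : H :=
  -- The adjoint of a coordinate multiplication scales the kernel function at `z` by `conj (z i)`;
  -- conjugating the point makes the eigenvalue `v i` and the section holomorphic on the ball.
  if h : v ∈ unitBall m then RKHS.kerFun H (⟨conjVec v, conjVec_mem h⟩ : unitBall m) 1 else 0

theorem conjKernelSection_of_mem {v : Cn m} (hv : v ∈ unitBall m) :
    conjKernelSection H v = RKHS.kerFun H (⟨conjVec v, conjVec_mem hv⟩ : unitBall m) 1 :=
  dif_pos hv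

theorem inner_conjKernelSection {u v : Cn m} (hu : u ∈ unitBall m) (hv : v ∈ unitBall m) :
    inner ℂ (conjKernelSection H u) (conjKernelSection H v) =
      RKHS.kernel H (⟨conjVec u, conjVec_mem hu⟩ : unitBall m) ⟨conjVec v, conjVec_mem hv⟩ 1 := by
  rw [conjKernelSection_of_mem hu, conjKernelSection_of_mem hv, RKHS.kerFun_inner,
    RKHS.kerFun_apply]
  simp

theorem isPowerSection_conjKernelSection {a : ℕ → ℝ}
    (hH : ∀ z w : unitBall m,
      HasSum (fun i : ℕ => (a i : ℂ) * (inner ℂ (w : Cn m) (z : Cn m)) ^ i) (RKHS.kernel H z w 1))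
    {M T : Fin m → H →L[ℂ] H} (hM : IsCoordMul M) (hT : ∀ i, T i = adjoint (M i)) :
    IsPowerSection a T (conjKernelSection H) where
  hasSum_inner u hu v hv := by
    have h := hH ⟨conjVec u, conjVec_mem hu⟩ ⟨conjVec v, conjVec_mem hv⟩
    simp only [inner_conjVec] at h
    rwa [inner_conjKernelSection hu hv]
  dense := by
    rw [eq_top_iff, ← RKHS.kerFun_dense H]
    refine Submodule.topologicalClosure_mono (Submodule.span_le.2 ?_)
    rintro _ ⟨x, c, rfl⟩
    have hx : conjVec (x : Cn m) ∈ unitBall m := conjVec_mem x.2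
    have h1 : RKHS.kerFun H x c = c • conjKernelSection H (conjVec (x : Cn m)) := by
      rw [conjKernelSection_of_mem hx, ← map_smul, smul_eq_mul, mul_one]
      congr 2
      ext i
      simp [conjVec]
    rw [h1]
    exact Submodule.smul_mem _ _ (Submodule.subset_span ⟨_, hx, rfl⟩)
  mem_jointKer v hv := by
    refine mem_jointKer_iff.2 fun i => ext_inner_left ℂ fun f => ?_
    rw [hT, adjoint_inner_right, inner_smul_right, conjKernelSection_of_mem hv, RKHS.inner_kerFun,
      RKHS.inner_kerFun, hM]
    simp [conjVec]

end ReproducingKernel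

end CDTuple

/-! ### The main theorem. -/

theorem theorem3p3 {m n : ℕ} (hm : 1 ≤ m) (hn : 1 ≤ n)
    -- the Hilbert space with reproducing kernel `∑ a(i) ⟨z, w⟩ ^ i`; `inner` is linear in its
    -- second argument, so that `⟨z, w⟩ = ∑ z_j * conj w_j` is `inner ℂ w z`
    (a : ℕ → ℝ) (ha : ∀ i, 0 < a i)
    {H : Type*} [NormedAddCommGroup H] [InnerProductSpace ℂ H] [CompleteSpace H]
    [RKHS ℂ H (CDTuple.unitBall m) ℂ]
    (hH : ∀ z w : CDTuple.unitBall m,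
      HasSum (fun i : ℕ => (a i : ℂ) * (inner ℂ (w : CDTuple.Cn m) (z : CDTuple.Cn m)) ^ i)
        (RKHS.kernel H z w 1))
    -- the Hilbert space with reproducing kernel `(1 - ⟨z, w⟩) ^ (-n)`
    {H' : Type*} [NormedAddCommGroup H'] [InnerProductSpace ℂ H'] [CompleteSpace H']
    [RKHS ℂ H' (CDTuple.unitBall m) ℂ]
    (hH' : ∀ z w : CDTuple.unitBall m,
      RKHS.kernel H' z w 1 = ((1 - inner ℂ (w : CDTuple.Cn m) (z : CDTuple.Cn m)) ^ n)⁻¹)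
    (M : Fin m → H →L[ℂ] H) (hM : CDTuple.IsCoordMul M)
    (S : Fin m → H' →L[ℂ] H') (hS : CDTuple.IsCoordMul S)
    (T : Fin m → H →L[ℂ] H) (hTM : ∀ i, T i = ContinuousLinearMap.adjoint (M i))
    (Sstar : Fin m → H' →L[ℂ] H') (hSstar : ∀ i, Sstar i = ContinuousLinearMap.adjoint (S i))
    (hT : CDTuple.IsCowenDouglas 1 (CDTuple.unitBall m) T)
    (hyp : CDTuple.IsHypercontraction n T) :
    CDTuple.IsCowenDouglas 1 (CDTuple.unitBall m) Sstar ∧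
    (CDTuple.Similar T Sstar ↔
      ∃ ψ : CDTuple.Cn m → ℝ,
        CDTuple.IsPlurisubharmonicOn ψ (CDTuple.unitBall m) ∧
        (∃ C : ℝ, ∀ w ∈ CDTuple.unitBall m, |ψ w| ≤ C) ∧
        ContDiffOn ℝ 2 ψ (CDTuple.unitBall m) ∧
        ∀ w ∈ CDTuple.unitBall m,
          CDTuple.curvature Sstar w - CDTuple.curvature T w = CDTuple.complexHessian ψ w) := by
  -- Writing `n = k + 1` gives `(1 - x)^(-n)` the coefficients `(l + k).choose k`.
  obtain ⟨k, rfl⟩ : ∃ k, n = k + 1 := ⟨n - 1, by omega⟩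
  set b : ℕ → ℝ := fun l => ((l + k).choose k : ℝ) with hb_def
  have hb : ∀ l, 0 < b l := fun l => by
    have := Nat.choose_pos (Nat.le_add_left k l)
    simp only [hb_def]
    exact_mod_cast this
  have hb0 : b 0 = 1 := by simp [hb_def]
  have hlt : ∀ z w : CDTuple.unitBall m,
      ‖(inner ℂ (w : CDTuple.Cn m) (z : CDTuple.Cn m) : ℂ)‖ < 1 := fun z w => by
    have hz := mem_ball_zero_iff.1 z.2
    have hw := mem_ball_zero_iff.1 w.2
    refine (norm_inner_le_norm _ _).trans_lt ?_
    nlinarith [norm_nonneg (z : CDTuple.Cn m), norm_nonneg (w : CDTuple.Cn m)]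
  have hγ := CDTuple.isPowerSection_conjKernelSection hH hM hTM
  have hγ' := CDTuple.isPowerSection_conjKernelSection (a := b) (H := H') (fun z w => by
    rw [hH', ← one_div]
    have h := hasSum_choose_mul_geometric_of_norm_lt_one k (hlt z w)
    simpa [hb_def] using h) hS hSstar
  set γ := CDTuple.conjKernelSection (m := m) H
  set γ' := CDTuple.conjKernelSection (m := m) H' with hγ'_def
  have hker : ∀ u ∈ CDTuple.unitBall m, ∀ v ∈ CDTuple.unitBall m,
      (1 - inner ℂ u v) ^ (k + 1) * inner ℂ (γ' u) (γ' v) = 1 := fun u hu v hv => by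
    rw [hγ'_def, CDTuple.inner_conjKernelSection hu hv, hH', CDTuple.inner_conjVec]
    refine mul_inv_cancel₀ (pow_ne_zero _ (sub_ne_zero.2 fun h => ?_))
    have := hlt ⟨v, hv⟩ ⟨u, hu⟩
    simp [← h] at this
  have hc : ∀ i, 0 ≤ backDiff^[k + 1] a i := hγ.backDiff_iterate_nonneg hm (ha 0) hn hyp
  have hSCD : CDTuple.IsCowenDouglas 1 (CDTuple.unitBall m) Sstar :=
    ⟨one_pos, hγ'.commute,
      fun w hw => hγ'.isClosed_range hb (fun δ hδ => mul_choose_succ_le_choose k hδ) hw,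
      hγ'.dense_iSup_jointKer, fun w hw => hγ'.finrank_jointKer hker hb0 hw⟩
  have hcurv : ∀ w ∈ CDTuple.unitBall m, CDTuple.curvature Sstar w - CDTuple.curvature T w =
      CDTuple.complexHessian (fun v => Real.log (‖γ v‖ ^ 2 / ‖γ' v‖ ^ 2)) w := fun w hw =>
    hγ.curvature_sub_curvature hγ' hm ha hb hT.finrank_jointKer hSCD.finrank_jointKer hw
  refine ⟨hSCD, fun hsim => ?_, ?_⟩
  · obtain ⟨C, hC⟩ := hγ.exists_norm_sq_div_le_of_similar hγ' hker hm ha hb hT.finrank_jointKer hsim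
    refine ⟨_, hγ.isPlurisubharmonicOn_log_div hγ' hker hm ha hb hc,
      ⟨max |Real.log (a 0)| |Real.log C|, fun w hw => ?_⟩,
      fun w hw => (hγ.contDiffAt_log_div hγ' hm ha hb hw).contDiffWithinAt, hcurv⟩
    have h1 := hγ.le_norm_sq_div hker hc hw
    exact abs_le_max_abs_abs (Real.log_le_log (ha 0) h1)
      (Real.log_le_log ((ha 0).trans_le h1) (hC w hw))
  · rintro ⟨ψ, -, ⟨C, hψC⟩, hψ, hHess⟩
    obtain ⟨B, hB⟩ := hγ.exists_partialSum_le hγ' hker hm ha hb hc hψC hψ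
      fun w hw => (hHess w hw).symm.trans (hcurv w hw)
    -- Summing `n` times recovers `a` from `c`, and turns `c 0 = a 0` and `partialSum c ≤ B` into `a
    -- 0 * b ≤ a ≤ B * b`.
    have hac : partialSum^[k + 1] (backDiff^[k + 1] a) = a :=
      partialSum_backDiff.iterate (k + 1) a
    have h1 : ∀ l, a l ≤ B * b l := fun l => by
      have := partialSum_iterate_le hB k l
      rwa [hac] at this
    have h2 : ∀ l, b l ≤ (a 0)⁻¹ * a l := fun l => by
      have := le_partialSum_iterate hc k l
      rw [hac, backDiff_iterate_zero] at this
      rwa [← div_eq_inv_mul, le_div_iff₀' (ha 0)]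
    exact hγ.similar hγ' (ha 0) (hb 0) h2 h1
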